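/- **Setting.** Let $n\ge 3$ and let $\widehat{\mathrm{Zig}}_n$ be the contracted zigzag graph: vertices $1,\dots,n$; slack edges $x_i:i\to i+1$ $(1\le i\le n-1)$; nonslack edges $y_0:1\to2$, $y_i:i\to i+2$ $(1\le i\le n-2)$ and $y_{n-1}:n-1\to n$. A *route* is a directed path from $1$ to $n$; a *prefix* (*suffix*) at $i$ is a path from $1$ to $i$ (from $i$ to $n$). The length-reverse-length (LRL) framing orders, at every inner vertex $2\le i\le n-1$, the incoming edges by $y_{i-2}\prec x_{i-1}$ and the outgoing edges by $x_i\prec y_i$. Distinct prefixes at $i$ are ordered by comparing the two incoming edges at the last vertex where they come together, distinct suffixes by comparing the two outgoing edges at the first vertex where they diverge. Two routes are *coherent* if there is no common inner vertex $i$ at which they split as $PiQ$, $P'iQ'$ with $P\prec P'$ and $Q'\prec Q$, or with $P'\prec P$ and $Q\prec Q'$. A *maximal clique* is an inclusion-maximal set $C$ of pairwise coherent routes, and $\Delta_C$ is the convex hull of the unit flows (indicator vectors in $\mathbb R^E$) of the routes in $C$. The triangulation $\mathcal T_n^{LRL}$ is the set of all $\Delta_C$; two of its simplices are *adjacent* in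 the dual graph $D(\mathcal T_n^{LRL})$ if their vertex sets differ by exactly one vertex. **Groves.** A *grove* $\Gamma=(\gamma_2,\dots,\gamma_{n-1})$ is a sequence of noncrossing bipartite trees; $\gamma_i$ has left vertices $l_1,\dots,l_{p_i}$ and right vertices $r_1,r_2$ (numbered from bottom to top, $r_1$ for $x_i$ and $r_2$ for $y_i$), with $p_i=\deg(x_{i-1})+\deg(y_{i-2})$, where $\deg(e)=1$ if $e$ starts at vertex $1$, and $\deg(x_j)$, $\deg(y_j)$ are the degrees of $r_1$, $r_2$ in $\gamma_j$ otherwise. The grove of a maximal clique $C$ has in $\gamma_i$ one left vertex for each prefix at $i$ that occurs in a route of $C$, in increasing order from bottom to top, joined to $r_1$ (to $r_2$) whenever some route of $C$ contains that prefix followed by $x_i$ (by $y_i$). An edge of $\gamma_i$ joining $l$ to the right vertex of $e:i\to j$, where $j<n$, *arrives* as a left vertex of $\gamma_j$: the edges at a right vertex arrive in unchanged order, and those arriving along $y_{j-2}$ lie below those arriving along $x_{j-1}$. **Elementary move.** For $2\le i\le n-1$, $m_i^+$ changes $\Gamma$ as follows. (1) In $\gamma_i$, let $l_j$ be the left vertex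 adjacent to both right vertices; if $j=1$, the move does not apply; otherwise replace the edge $l_jr_1$ by $l_{j-1}r_2$. (2) If $i<n-1$: if the top left vertex of $\gamma_{i+1}$ is adjacent to both right vertices, the move does not apply; otherwise delete it together with its edge. (3) If $i<n-2$: add to $\gamma_{i+2}$ a new bottom left vertex, joined to $r_1$ only. All other trees are unchanged. **Tracking and offsets.** An edge of a tree $\gamma_i$ that corresponds to an edge $i\to j$ of the graph is *trackable* if $j=n$, or if it arrives in $\gamma_j$ at a left vertex with exactly one edge and this edge is trackable. The sequence of offsets $\mathbf z^{(i)}(\Gamma)=(z_{i+1},\dots,z_{n-1})$ is empty for $i=n-1$. Otherwise track the topmost edge at $r_1$ in $\gamma_i$. When the process arrives at a left vertex $l$ of $\gamma_j$ $(j\le n-1)$: if $l$ is adjacent to both right vertices, set $z_k=0$ for all $k\ge j$ and stop; if $l$ is adjacent to $r_1$ only, let $z_j$ be minus the number of edges at $r_1$ above $lr_1$, and continue with the edge $lr_1$, which arrives in $\gamma_{j+1}$ (stop if $j=n-1$); if $l$ is adjacent to $r_2$ only, let $z_j$ be the number of edges at $r_2$ below $lr_2$, set $z_{j+1}=\varnothing$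 if $j\le n-2$, and continue with the edge $lr_2$, which arrives in $\gamma_{j+2}$ (stop if $j\ge n-2$). **Theorem.** Let $\Gamma$ and $\Gamma'$ be groves as above with $\Gamma'=m_i^+(\Gamma)$ for some $2\le i\le n-1$. Then there is exactly one maximal clique $C$ whose grove is $\Gamma$ and exactly one maximal clique $C'$ whose grove is $\Gamma'$, and the following are equivalent: 1. the simplices $\Delta_C$ and $\Delta_{C'}$ are adjacent in $D(\mathcal T_n^{LRL})$; 2. the sequence of offsets $\mathbf z^{(i)}(\Gamma)$ contains no zeroes; 3. the topmost edge at $r_1$ in $\gamma_i$ is trackable; 4. if $P$ is the prefix at $i$ corresponding to the left end of the topmost edge at $r_1$ in $\gamma_i$, then exactly one route of $C$ begins with $P$ followed by $x_i$. -/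

import Mathlib

namespace ZigZag

/-! ### The contracted zigzag graph and its routes -/

/-- Labels of edges: `x i` are the slack edges, `y i` the nonslack edges. -/
inductive EdgeLabel : Type
  | x (i : ℕ) : EdgeLabel
  | y (i : ℕ) : EdgeLabel

namespace EdgeLabel

/-- The edges of the contracted zigzag graph on the vertices `1, …, n`:
`x_1, …, x_{n-1}` and `y_0, …, y_{n-1}`. -/
def IsEdge (n : ℕ) : EdgeLabel → Prop
  | x i => 1 ≤ i ∧ i < n
  | y i => i < n

/-- Initial vertex: `x_i` and `y_i` start at `i`, except that `y_0` starts at `1`. -/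
def src : EdgeLabel → ℕ
  | x i => i
  | y i => max i 1

/-- Final vertex: `x_i` ends at `i + 1`; `y_i` ends at `i + 2`, except that `y_{n-1}` ends
at `n`. -/
def tgt (n : ℕ) : EdgeLabel → ℕ
  | x i => i + 1
  | y i => min (i + 2) n

end EdgeLabel

open EdgeLabel

/-- The type of edges of the contracted zigzag graph on `1, …, n`. -/
abbrev Edge (n : ℕ) : Type := {e : EdgeLabel // IsEdge n e}

/-- `IsPath n a P b`: the list of edges `P` is a directed path from `a` to `b`. -/
def IsPath (n : ℕ) : ℕ → List EdgeLabel → ℕ → Prop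
  | a, [], b => a = b
  | a, e :: P, b => IsEdge n e ∧ src e = a ∧ IsPath n (tgt n e) P b

/-- Routes are the paths from `1` to `n`. A prefix at `i` is a path from `1` to `i`, and a suffix
at `i` is a path from `i` to `n`. -/
abbrev Route (n : ℕ) : Type := {R : List EdgeLabel // IsPath n 1 R n}

/-! ### The length-reverse-length framing, coherence, maximal cliques -/

/-- The framing on incoming edges of an inner vertex `j`: `y_{j-2}` comes before `x_{j-1}`. -/
def InLT (n : ℕ) (e e' : EdgeLabel) : Prop :=
  ∃ j, 2 ≤ j ∧ j < n ∧ e = y (j - 2) ∧ e' = x (j - 1)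

/-- The framing on outgoing edges of an inner vertex `k`: `x_k` comes before `y_k`. -/
def OutLT (n : ℕ) (e e' : EdgeLabel) : Prop :=
  ∃ k, 2 ≤ k ∧ k < n ∧ e = x k ∧ e' = y k

/-- The order induced on prefixes at an inner vertex: compare the two edges along which the
prefixes come together for the last time. -/
def PrefixLT (n : ℕ) (P P' : List EdgeLabel) : Prop :=
  ∃ A A' S e e', P = A ++ e :: S ∧ P' = A' ++ e' :: S ∧ InLT n e e'

/-- The order induced on suffixes at an inner vertex: compare the two edges along which the
suffixes diverge for the first time. -/
def SuffixLT (n : ℕ) (Q Q' : List EdgeLabel) : Prop :=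
  ∃ S A A' e e', Q = S ++ e :: A ∧ Q' = S ++ e' :: A' ∧ OutLT n e e'

/-- Two routes are coherent if at no common inner vertex `i`, where they split as `PiQ` and
`P'iQ'`, the prefixes and the suffixes are in opposite orders. -/
def Coherent {n : ℕ} (R R' : Route n) : Prop :=
  ∀ i, 2 ≤ i → i < n → ∀ P Q P' Q' : List EdgeLabel,
    R.1 = P ++ Q → R'.1 = P' ++ Q' → IsPath n 1 P i → IsPath n 1 P' i →
      ¬ (PrefixLT n P P' ∧ SuffixLT n Q' Q) ∧ ¬ (PrefixLT n P' P ∧ SuffixLT n Q Q')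

/-- A clique is a set of pairwise coherent routes. -/
def IsClique {n : ℕ} (C : Set (Route n)) : Prop := C.Pairwise Coherent

/-- The inclusion-maximal cliques. -/
abbrev MaximalClique (n : ℕ) : Type := {C : Set (Route n) // Maximal IsClique C}

/-! ### The triangulation of the flow polytope and its dual graph -/

open Classical in
/-- A route as a unit flow, i.e. the indicator function of its set of edges. -/
noncomputable def routeFlow {n : ℕ} (R : Route n) : Edge n → ℝ :=
  fun e => if e.1 ∈ R.1 then 1 else 0

/-- The simplex of a clique: the convex hull of its routes. -/
def cliqueSimplex {n : ℕ} (C : Set (Route n)) : Set (Edge n → ℝ) :=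
  convexHull ℝ (routeFlow '' C)

/-- The (maximal cells of the) triangulation: all simplices of maximal cliques. -/
def triangulation (n : ℕ) : Set (Set (Edge n → ℝ)) :=
  {Δ | ∃ C : MaximalClique n, Δ = cliqueSimplex C.1}

/-- The simplex of a maximal clique as a member of the triangulation. -/
def MaximalClique.simplex {n : ℕ} (C : MaximalClique n) : triangulation n :=
  ⟨cliqueSimplex C.1, C, rfl⟩

/-- The dual graph of the triangulation: two simplices are adjacent if their sets of vertices
differ by exactly one vertex. -/
def dualGraph (n : ℕ) : SimpleGraph (triangulation n) where
  Adj Δ Δ' :=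
    ((Δ : Set (Edge n → ℝ)).extremePoints ℝ \
        (Δ' : Set (Edge n → ℝ)).extremePoints ℝ).ncard = 1 ∧
      ((Δ' : Set (Edge n → ℝ)).extremePoints ℝ \
        (Δ : Set (Edge n → ℝ)).extremePoints ℝ).ncard = 1
  symm := ⟨fun _ _ h => ⟨h.2, h.1⟩⟩
  loopless := ⟨fun _ h => by simp at h⟩

/-! ### Groves -/

/-- A bipartite graph with left vertices `l_1, …, l_p` and right vertices `r_1, r_2`, both numbered
from bottom to top. The pair `(a, b)` in `edges` stands for the edge joining `l_a` to `r_b`. -/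
@[ext]
structure BipGraph : Type where
  p : ℕ
  edges : Set (ℕ × ℕ)

namespace BipGraph

/-- The underlying simple graph on the left and right vertices. -/
def graph (T : BipGraph) : SimpleGraph (Set.Icc 1 T.p ⊕ Set.Icc 1 2) :=
  SimpleGraph.fromRel fun u v =>
    ∃ (a : Set.Icc 1 T.p) (b : Set.Icc 1 2), u = Sum.inl a ∧ v = Sum.inr b ∧
      ((a : ℕ), (b : ℕ)) ∈ T.edges

/-- `T` is a noncrossing bipartite tree. -/
structure IsNoncrossingTree (T : BipGraph) : Prop where
  mem_Icc : ∀ a b, (a, b) ∈ T.edges → a ∈ Set.Icc 1 T.p ∧ b ∈ Set.Icc 1 2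
  isTree : T.graph.IsTree
  noncrossing : ∀ a b a' b', (a, b) ∈ T.edges → (a', b') ∈ T.edges → a < a' → b ≤ b'

/-- The degree of the right vertex `r_b`. -/
noncomputable def rightDeg (T : BipGraph) (b : ℕ) : ℕ := {a | (a, b) ∈ T.edges}.ncard

/-- The position, from the bottom, of the edge `l_a r_b` among the edges at `r_b`. -/
noncomputable def rank (T : BipGraph) (a b : ℕ) : ℕ := {a' | a' ≤ a ∧ (a', b) ∈ T.edges}.ncard

/-- The left end of the topmost edge at `r_b`. -/
noncomputable def topLeft (T : BipGraph) (b : ℕ) : ℕ := sSup {a | (a, b) ∈ T.edges}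

end BipGraph

/-- The edge of the graph corresponding to the right vertex `r_b` of the `i`-th tree:
`x_i` for `b = 1` and `y_i` for `b = 2`. -/
def outEdge (i b : ℕ) : EdgeLabel := if b = 1 then x i else y i

/-- The degree attached to `x_j`: one if `x_j` starts at the source, and otherwise the degree
of `r_1` in the `j`-th tree. -/
noncomputable def degX (γ : ℕ → BipGraph) (j : ℕ) : ℕ := if j ≤ 1 then 1 else (γ j).rightDeg 1

/-- The degree attached to `y_j`: one if `y_j` starts at the source (`j = 0, 1`), and otherwise the
degree of `r_2` in the `j`-th tree. -/
noncomputable def degY (γ : ℕ → BipGraph) (j : ℕ) : ℕ := if j ≤ 1 then 1 else (γ j).rightDeg 2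

/-- A grove is a sequence of noncrossing bipartite trees `γ_2, …, γ_{n-1}`, where the number of left
vertices of `γ_i` is the sum of the degrees attached to the two edges entering `i`.
Only the values `tree i` with `2 ≤ i < n` are ever used. -/
structure Grove (n : ℕ) : Type where
  tree : ℕ → BipGraph
  noncrossingTree : ∀ i, 2 ≤ i → i < n → (tree i).IsNoncrossingTree
  leftCount : ∀ i, 2 ≤ i → i < n → (tree i).p = degX tree (i - 1) + degY tree (i - 2)

/-! ### The grove of a maximal clique -/

/-- The prefixes at `i` that occur in at least one route of `C`. -/
def prefixesAt {n : ℕ} (C : Set (Route n)) (i : ℕ) : Set (List EdgeLabel) :=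
  {P | IsPath n 1 P i ∧ ∃ R ∈ C, P <+: R.1}

/-- The number, from the bottom, of the left vertex that corresponds to the prefix `P`. -/
noncomputable def leftIndex {n : ℕ} (C : Set (Route n)) (i : ℕ) (P : List EdgeLabel) : ℕ :=
  {P' ∈ prefixesAt C i | PrefixLT n P' P}.ncard + 1

/-- The `i`-th tree of the clique `C`: one left vertex for every prefix at `i` that occurs in `C`,
in the order of the prefixes, and an edge from a prefix to an outgoing edge whenever some
route in `C` contains both. -/
noncomputable def cliqueTree {n : ℕ} (C : Set (Route n)) (i : ℕ) : BipGraph where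
  p := (prefixesAt C i).ncard
  edges := {q | ∃ P ∈ prefixesAt C i, q.1 = leftIndex C i P ∧ q.2 ∈ Set.Icc 1 2 ∧
    ∃ R ∈ C, P ++ [outEdge i q.2] <+: R.1}

/-- The maximal clique `C` and the grove `Γ` correspond to each other. -/
def Corresponds {n : ℕ} (C : MaximalClique n) (Γ : Grove n) : Prop :=
  ∀ i, 2 ≤ i → i < n → Γ.tree i = cliqueTree C.1 i

/-! ### Elementary moves -/

/-- `IsPlusMove i Γ Γ'`: the elementary move `m_i^+` applies to `Γ`, and the result is `Γ'`. -/
structure IsPlusMove {n : ℕ} (i : ℕ) (Γ Γ' : Grove n) : Prop where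
  two_le : 2 ≤ i
  lt : i < n
  /-- In the `i`-th tree, the left vertex `l_j` joined to both right vertices is not the bottom one,
  and the edge `l_j r_1` is replaced by `l_{j-1} r_2`. -/
  tree_i : ∃ j, 1 < j ∧ (j, 1) ∈ (Γ.tree i).edges ∧ (j, 2) ∈ (Γ.tree i).edges ∧
    Γ'.tree i = ⟨(Γ.tree i).p, insert (j - 1, 2) ((Γ.tree i).edges \ {(j, 1)})⟩
  /-- In the next tree, the top left vertex is not joined to both right vertices, and it is deleted
  with its edge. -/
  tree_succ : i + 1 < n →
    ¬ (((Γ.tree (i + 1)).p, 1) ∈ (Γ.tree (i + 1)).edges ∧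
        ((Γ.tree (i + 1)).p, 2) ∈ (Γ.tree (i + 1)).edges) ∧
      Γ'.tree (i + 1) = ⟨(Γ.tree (i + 1)).p - 1,
        {q ∈ (Γ.tree (i + 1)).edges | q.1 ≠ (Γ.tree (i + 1)).p}⟩
  /-- In the tree after that, a new bottom left vertex joined to `r_1` is added; the old left
  vertices are renumbered. -/
  tree_add_two : i + 2 < n →
    Γ'.tree (i + 2) = ⟨(Γ.tree (i + 2)).p + 1,
      insert (1, 1) ((fun q => (q.1 + 1, q.2)) '' (Γ.tree (i + 2)).edges)⟩
  /-- All other trees are unchanged. -/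
  tree_other : ∀ k, 2 ≤ k → k < n → k ≠ i → k ≠ i + 1 → k ≠ i + 2 → Γ'.tree k = Γ.tree k

/-! ### Tracking and offsets -/

/-- The left vertex as which the edge `l_a r_b` of the `j`-th tree arrives in the tree at the end of
the corresponding edge of the graph. The edges at `r_b` arrive in unchanged order. At any inner
vertex those that arrive along a nonslack edge lie below those that arrive along a slack edge,
so `x_j` enters vertex `j + 1` above the left vertices coming from `y_{j-1}`, while `y_j`
enters vertex `j + 2` at the bottom. -/
noncomputable def arrival (γ : ℕ → BipGraph) (j a b : ℕ) : ℕ :=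
  if b = 1 then degY γ (j - 1) + (γ j).rank a 1 else (γ j).rank a 2

/-- `Trackable n γ i a b`: the edge `l_a r_b` of the `i`-th tree is trackable. That is, it leads to
the vertex `n`, or it arrives at a left vertex that has exactly one edge, and this
edge is trackable. -/
inductive Trackable (n : ℕ) (γ : ℕ → BipGraph) : ℕ → ℕ → ℕ → Prop
  | done (i a b : ℕ) (hab : (a, b) ∈ (γ i).edges) (hn : tgt n (outEdge i b) = n) :
      Trackable n γ i a b
  | step (i a b j c : ℕ) (hab : (a, b) ∈ (γ i).edges) (hj : tgt n (outEdge i b) = j) (hjn : j < n)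
      (hc : ∀ c', (arrival γ i a b, c') ∈ (γ j).edges ↔ c' = c)
      (ht : Trackable n γ j (arrival γ i a b) c) : Trackable n γ i a b

open Classical in
/-- `offsetsFrom γ k j a` lists the `k` offsets `z_j, …, z_{j+k-1}` when the tracking process arrives
in the `j`-th tree at the left vertex `l_a`; here `j + k = n`. The entry `∅` is `none`. -/
noncomputable def offsetsFrom (γ : ℕ → BipGraph) : ℕ → ℕ → ℕ → List (Option ℤ)
  | 0, _, _ => []
  | k + 1, j, a =>
    if (a, 1) ∈ (γ j).edges ∧ (a, 2) ∈ (γ j).edges then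
      List.replicate (k + 1) (some 0)
    else if (a, 1) ∈ (γ j).edges then
      some (-({a' | a < a' ∧ (a', 1) ∈ (γ j).edges}.ncard : ℤ)) ::
        offsetsFrom γ k (j + 1) (arrival γ j a 1)
    else
      some ({a' | a' < a ∧ (a', 2) ∈ (γ j).edges}.ncard : ℤ) ::
        match k with
        | 0 => []
        | k' + 1 => none :: offsetsFrom γ k' (j + 2) (arrival γ j a 2)

/-- The sequence of offsets `(z_{i+1}, …, z_{n-1})` of the grove `Γ` at `i`, obtained by tracking the
topmost edge at `r_1` in the `i`-th tree. -/
noncomputable def Grove.offsets {n : ℕ} (Γ : Grove n) (i : ℕ) : List (Option ℤ) :=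
  offsetsFrom Γ.tree (n - 1 - i) (i + 1) (arrival Γ.tree i ((Γ.tree i).topLeft 1) 1)

end ZigZag

namespace ZigZag

open EdgeLabel

/-! ### Paths -/

/-! In a noncrossing tree with two right vertices exactly one left vertex is joined to both, those
below it only to `r_1`, those above it only to `r_2`. A grove is therefore two degree sequences `q`,
`d` satisfying `q (k+2) + d (k+2) = q (k+1) + d k + 1`. It acts like a railway: a path sits at a
left vertex of every tree it visits, may leave by the edges at that vertex, and each edge prescribes
the next position.

Prefixes at `k` that follow these rules correspond, in order, to the left vertices of the `k`-th
tree. Paths never cross, so the routes that follow the grove form a clique; a route breaking a rule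
is incoherent with one leaving from the branching vertex, so the clique is maximal
(`maximal_followingRoutes`). Its trees are the given ones, and any clique with these trees is
contained in it; this gives existence and uniqueness (`corresponds_iff`).

The move `m_i^+` lowers `q i` by one. A route of `C` survives unless it uses the topmost edge at
`r_1` in `γ_i`, hence starts with one fixed prefix followed by `x_i`; a route of `C'` is new only if
it starts with one fixed prefix followed by `y_i` (`follows_or`, `follows_or'`). The simplices are
convex hulls of vertices of a cube, so adjacency means that exactly one route is lost and exactly
one gained. Both families have the same tails, because the detours `x_i y_{i+1}` and `y_i x_{i+2}`
are forced and meet at `i + 3` in the same position, or the graph ends before that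
(`uniqueSuffix_iff`).

All four conditions thus say that there is a unique way to continue after the topmost edge at `r_1`.
Tracking fails, and an offset vanishes, exactly when this continuation reaches a branching vertex
(`trackable_iff`, `zero_notMem_offsetsFrom`), and from there at least two suffixes exist
(`not_uniqueSuffix`). -/

theorem src_pos {n : ℕ} {e : EdgeLabel} (he : IsEdge n e) : 1 ≤ src e := by
  cases e <;> simp_all [IsEdge, src]

theorem src_lt_tgt {n : ℕ} (hn : 2 ≤ n) {e : EdgeLabel} (he : IsEdge n e) :
    src e < tgt n e := by
  cases e <;> simp only [IsEdge, src, tgt] at * <;> omega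

theorem tgt_le {n : ℕ} {e : EdgeLabel} (he : IsEdge n e) : tgt n e ≤ n := by
  cases e <;> simp only [IsEdge, tgt] at * <;> omega

/-- Below `n` the truncation in `tgt` is inactive, so the label can be recovered from the target. -/
theorem eq_of_tgt_lt {n : ℕ} {e : EdgeLabel} (he : IsEdge n e) (ht : tgt n e < n) :
    2 ≤ tgt n e ∧ (e = x (tgt n e - 1) ∨ e = y (tgt n e - 2)) := by
  cases e <;> simp only [IsEdge, tgt, x.injEq, y.injEq, reduceCtorEq, or_false, false_or] at * <;>
    omega

theorem isPath_append {n a b : ℕ} {P Q : List EdgeLabel} :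
    IsPath n a (P ++ Q) b ↔ ∃ c, IsPath n a P c ∧ IsPath n c Q b := by
  induction P generalizing a with
  | nil => simp [IsPath]
  | cons e P ih => simp [IsPath, ih, and_assoc]

theorem isPath_concat {n a b : ℕ} {P : List EdgeLabel} {e : EdgeLabel} :
    IsPath n a (P ++ [e]) b ↔ IsPath n a P (src e) ∧ IsEdge n e ∧ tgt n e = b := by
  rw [isPath_append]
  constructor
  · rintro ⟨c, h, h1, rfl, h2⟩
    exact ⟨h, h1, h2⟩
  · rintro ⟨h, h1, h2⟩
    exact ⟨_, h, h1, rfl, h2⟩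

theorem IsPath.le {n a b : ℕ} (hn : 2 ≤ n) {P : List EdgeLabel} (h : IsPath n a P b) :
    a ≤ b := by
  induction P generalizing a with
  | nil => exact le_of_eq h
  | cons e P ih =>
    obtain ⟨he, rfl, h⟩ := h
    exact (src_lt_tgt hn he).le.trans (ih h)

theorem IsPath.eq_nil {n a : ℕ} (hn : 2 ≤ n) {P : List EdgeLabel} (h : IsPath n a P a) :
    P = [] := by
  cases P with
  | nil => rfl
  | cons e P =>
    obtain ⟨he, ha, h⟩ := h
    have := src_lt_tgt hn he
    have := IsPath.le hn h
    omega

theorem IsPath.end_unique {n a b c : ℕ} {P : List EdgeLabel} (h : IsPath n a P b)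
    (h' : IsPath n a P c) : b = c := by
  induction P generalizing a with
  | nil => exact h.symm.trans h'
  | cons e P ih => exact ih h.2.2 h'.2.2

theorem IsPath.src_mem {n a b : ℕ} (hn : 2 ≤ n) {P : List EdgeLabel} (h : IsPath n a P b)
    {e : EdgeLabel} (he : e ∈ P) : IsEdge n e ∧ a ≤ src e := by
  induction P generalizing a with
  | nil => simp at he
  | cons f P ih =>
    obtain ⟨hf, rfl, h⟩ := h
    rcases List.mem_cons.1 he with rfl | he
    · exact ⟨hf, le_rfl⟩
    · exact ⟨(ih h he).1, (src_lt_tgt hn hf).le.trans (ih h he).2⟩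

/-- A path is determined by its set of edges. -/
theorem IsPath.eq_of_mem_iff {n a b : ℕ} (hn : 2 ≤ n) {P P' : List EdgeLabel}
    (h : IsPath n a P b) (h' : IsPath n a P' b) (hmem : ∀ e, e ∈ P ↔ e ∈ P') : P = P' := by
  induction P generalizing a P' with
  | nil => exact (List.eq_nil_iff_forall_not_mem.2 fun e he => by simpa using (hmem e).2 he).symm
  | cons e P ih =>
    cases P' with
    | nil => simpa using hmem e
    | cons e' P' =>
      obtain ⟨he, rfl, h⟩ := h
      obtain ⟨he', hs, h'⟩ := h'
      have h1 := src_lt_tgt hn he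
      have h2 := src_lt_tgt hn he'
      have notMem : ∀ f, src f = src e → f ∉ P ∧ f ∉ P' := fun f hf =>
        ⟨fun hm => by have := (h.src_mem hn hm).2; omega,
          fun hm => by have := (h'.src_mem hn hm).2; omega⟩
      obtain rfl : e = e' := by
        rcases List.mem_cons.1 ((hmem e).1 (by simp)) with h0 | h0
        · exact h0
        · exact absurd h0 (notMem e rfl).2
      rw [ih h h' fun f => ?_]
      by_cases hf : f = e
      · subst hf
        simp [notMem f rfl]
      · simpa [hf] using hmem f

theorem PrefixLT.append {n : ℕ} {P P' : List EdgeLabel} (h : PrefixLT n P P')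
    (S : List EdgeLabel) : PrefixLT n (P ++ S) (P' ++ S) := by
  obtain ⟨A, A', T, e, e', rfl, rfl, h⟩ := h
  exact ⟨A, A', T ++ S, e, e', by simp, by simp, h⟩

/-- Distinct prefixes at an inner vertex are comparable. -/
theorem prefixLT_total {n k : ℕ} (hn : 2 ≤ n) (hk : k < n) {P P' : List EdgeLabel}
    (h : IsPath n 1 P k) (h' : IsPath n 1 P' k) (hne : P ≠ P') :
    PrefixLT n P P' ∨ PrefixLT n P' P := by
  induction P using List.reverseRecOn generalizing k P' with
  | nil =>
    obtain rfl : 1 = k := h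
    exact absurd (h'.eq_nil hn).symm hne
  | append_singleton A e ih =>
    rcases List.eq_nil_or_concat' P' with rfl | ⟨A', e', rfl⟩
    · obtain rfl : 1 = k := h'
      exact absurd (h.eq_nil hn) hne
    obtain ⟨hA, he, rfl⟩ := isPath_concat.1 h
    obtain ⟨hA', he', ht⟩ := isPath_concat.1 h'
    by_cases hee : e = e'
    · subst hee
      have := src_lt_tgt hn he
      exact (ih (by omega) hA hA' fun hAA => hne (by rw [hAA])).imp
        (fun h => h.append _) fun h => h.append _
    · obtain ⟨h2, hx⟩ := eq_of_tgt_lt he hk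
      obtain ⟨-, hx'⟩ := eq_of_tgt_lt he' (ht ▸ hk)
      rw [ht] at hx'
      generalize tgt n e = j at *
      rcases hx with rfl | rfl <;> rcases hx' with rfl | rfl
      · exact absurd rfl hee
      · exact .inr ⟨A', A, [], _, _, rfl, rfl, j, h2, hk, rfl, rfl⟩
      · exact .inl ⟨A, A', [], _, _, rfl, rfl, j, h2, hk, rfl, rfl⟩
      · exact absurd rfl hee

/-! ### Following a grove

A grove is encoded by the degrees `q k` and `d k` of the right vertices `r_1` and `r_2` of its
`k`-th tree, in which `l_a` is joined to `r_1` for `a ≤ q k` and to `r_2` for `q k ≤ a`. -/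

/-- The degrees of the right vertices of a grove. -/
structure IsDegreeSeq (n : ℕ) (q d : ℕ → ℕ) : Prop where
  three_le : 3 ≤ n
  q_zero : q 0 = 1
  q_one : q 1 = 1
  d_zero : d 0 = 1
  d_one : d 1 = 1
  q_pos : ∀ k, 1 ≤ k → k < n → 1 ≤ q k
  d_pos : ∀ k, 1 ≤ k → k < n → 1 ≤ d k
  recurrence : ∀ k, k + 2 < n → q (k + 2) + d (k + 2) = q (k + 1) + d k + 1

/-- The left vertex at which a path at `l_a` arrives along an edge. -/
def stepIndex (q d : ℕ → ℕ) (a : ℕ) : EdgeLabel → ℕ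
  | x k => d (k - 1) + a
  | y k => a + 1 - q k

/-- The left vertex `l_a` is joined to the right vertex of the given edge. -/
def Admissible (q : ℕ → ℕ) (a : ℕ) : EdgeLabel → Prop
  | x k => a ≤ q k
  | y k => q k ≤ a

/-- The left vertex at which a path arrives. -/
def pathIndex (q d : ℕ → ℕ) (a : ℕ) (P : List EdgeLabel) : ℕ := P.foldl (stepIndex q d) a

/-- All steps of a path are admissible. -/
def Follows (q d : ℕ → ℕ) : ℕ → List EdgeLabel → Prop
  | _, [] => True
  | a, e :: P => Admissible q a e ∧ Follows q d (stepIndex q d a e) P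

/-- The numbers of the left vertices of the `k`-th tree. -/
def ValidIndex (q d : ℕ → ℕ) (k a : ℕ) : Prop := 1 ≤ a ∧ a + 1 ≤ q k + d k

/-- The prefixes at `k` that follow the grove. -/
def followingPrefixes (n : ℕ) (q d : ℕ → ℕ) (k : ℕ) : Set (List EdgeLabel) :=
  {P | IsPath n 1 P k ∧ Follows q d 1 P}

/-- The routes that follow the grove. -/
def followingRoutes (n : ℕ) (q d : ℕ → ℕ) : Set (Route n) := {R | Follows q d 1 R.1}

variable {n : ℕ} {q d : ℕ → ℕ}

@[simp]
theorem pathIndex_nil (a : ℕ) : pathIndex q d a [] = a := rfl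

@[simp]
theorem pathIndex_cons (a : ℕ) (e : EdgeLabel) (P : List EdgeLabel) :
    pathIndex q d a (e :: P) = pathIndex q d (stepIndex q d a e) P := rfl

theorem pathIndex_append (a : ℕ) (P Q : List EdgeLabel) :
    pathIndex q d a (P ++ Q) = pathIndex q d (pathIndex q d a P) Q := by
  simp [pathIndex]

theorem follows_append {a : ℕ} {P Q : List EdgeLabel} :
    Follows q d a (P ++ Q) ↔ Follows q d a P ∧ Follows q d (pathIndex q d a P) Q := by
  induction P generalizing a with
  | nil => simp [Follows]
  | cons e P ih => simp [Follows, ih, and_assoc]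

theorem follows_concat {a : ℕ} {P : List EdgeLabel} {e : EdgeLabel} :
    Follows q d a (P ++ [e]) ↔ Follows q d a P ∧ Admissible q (pathIndex q d a P) e := by
  simp [follows_append, Follows]

/-- Slack steps translate positions and nonslack steps translate them back, so order is kept. Only
the lower path must be admissible: this prevents the natural subtraction in `stepIndex` from
truncating. -/
theorem pathIndex_lt {a a' : ℕ} (haa : a < a') {S : List EdgeLabel} (h : Follows q d a S) :
    pathIndex q d a S < pathIndex q d a' S := by
  induction S generalizing a a' with
  | nil => exact haa
  | cons e S ih =>
    refine ih ?_ h.2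
    have := h.1
    cases e <;> simp only [Admissible, stepIndex] at * <;> omega

/-! ### Prefixes correspond to left vertices -/

namespace IsDegreeSeq

variable (D : IsDegreeSeq n q d)

include D

theorem validIndex_one : ValidIndex q d 1 1 := by
  simp [ValidIndex, D.q_one, D.d_one]

/-- The recurrence says that the tree at `k + 2` has `d k + q (k+1)` left vertices: the lowest `d k`
receive the edges at `r_2` of the tree at `k`, the others those at `r_1` of the tree at `k + 1`. -/
theorem validIndex_step {a : ℕ} {e : EdgeLabel} (he : IsEdge n e) (ht : tgt n e < n)
    (hv : ValidIndex q d (src e) a) (ha : Admissible q a e) :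
    ValidIndex q d (tgt n e) (stepIndex q d a e) := by
  have h0 := D.q_zero
  have h1 := D.q_one
  have h2 := D.d_zero
  have h3 := D.d_one
  cases e with
  | x k =>
    simp only [IsEdge, src, tgt, Admissible, stepIndex, ValidIndex] at *
    obtain ⟨k, rfl⟩ := Nat.exists_eq_add_of_le' he.1
    have := D.recurrence k ht
    have e1 : k + 1 - 1 = k := rfl
    have e2 : k + 1 + 1 = k + 2 := rfl
    simp only [e1, e2] at *
    omega
  | y k =>
    simp only [IsEdge, src, tgt, Admissible, stepIndex, ValidIndex] at *
    have hk : k + 2 < n := by omega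
    have := D.recurrence k hk
    have := D.q_pos (k + 1) (by omega) (by omega)
    rw [min_eq_left hk.le]
    -- `y_0` starts at vertex `1`, so validity refers to the degrees at `1` and the step to those at
    -- `0`; all of them equal one.
    rcases Nat.eq_zero_or_pos k with rfl | hk0
    · simp only [zero_le, sup_of_le_right] at hv
      omega
    · rw [max_eq_left hk0] at hv
      omega

theorem validIndex_path {j k a : ℕ} (hk : k < n) {P : List EdgeLabel}
    (h : IsPath n j P k) (hv : ValidIndex q d j a) (hf : Follows q d a P) :
    ValidIndex q d k (pathIndex q d a P) := by
  have hn : 2 ≤ n := by have := D.three_le; omega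
  induction P generalizing j a with
  | nil => obtain rfl : j = k := h; exact hv
  | cons e P ih =>
    obtain ⟨he, rfl, h⟩ := h
    exact ih h (D.validIndex_step he ((h.le hn).trans_lt hk) hv hf.1) hf.2

theorem validIndex_prefix {k : ℕ} (hk : k < n) {P : List EdgeLabel}
    (h : P ∈ followingPrefixes n q d k) : ValidIndex q d k (pathIndex q d 1 P) :=
  D.validIndex_path hk h.1 D.validIndex_one h.2

/-- The left vertices of a tree are numbered in the order of the prefixes. -/
theorem pathIndex_lt_of_prefixLT {k k' : ℕ} {P P' : List EdgeLabel}
    (h : P ∈ followingPrefixes n q d k) (h' : P' ∈ followingPrefixes n q d k')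
    (hlt : PrefixLT n P P') : pathIndex q d 1 P < pathIndex q d 1 P' := by
  obtain ⟨A, A', S, e, e', rfl, rfl, j, hj, hjn, rfl, rfl⟩ := hlt
  obtain ⟨c, hA, he, hc, -⟩ := isPath_append.1 h.1
  obtain ⟨c', hA', he', hc', -⟩ := isPath_append.1 h'.1
  have hf := follows_append.1 h.2
  have hf' := follows_append.1 h'.2
  have hcn : c < n := by simp only [src, IsEdge] at hc he; omega
  have hcn' : c' < n := by simp only [src, IsEdge] at hc' he'; omega
  have hv := D.validIndex_prefix hcn ⟨hA, hf.1⟩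
  have hv' := D.validIndex_prefix hcn' ⟨hA', hf'.1⟩
  rw [pathIndex_append, pathIndex_append, pathIndex_cons, pathIndex_cons]
  -- It suffices to compare positions where the prefixes come together. By validity, arriving along
  -- `y_{j-2}` gives a position at most `d (j-2)`, while arriving along `x_{j-1}` gives a larger
  -- one.
  refine pathIndex_lt ?_ hf.2.2
  have h1 := hf.2.1
  obtain ⟨j, rfl⟩ := Nat.exists_eq_add_of_le' hj
  have e1 : j + 2 - 2 = j := rfl
  have e2 : j + 2 - 1 - 1 = j := rfl
  simp only [e1, stepIndex, e2, src, Admissible, ValidIndex] at *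
  rcases Nat.eq_zero_or_pos j with rfl | hj0
  · have h0 := D.q_zero
    have h1 := D.q_one
    have h2 := D.d_zero
    have h3 := D.d_one
    obtain rfl : c = 1 := by omega
    omega
  · obtain rfl : c = j := by omega
    omega

theorem pathIndex_injOn {k : ℕ} (hk : k < n) :
    Set.InjOn (pathIndex q d 1) (followingPrefixes n q d k) := by
  intro P hP P' hP' heq
  by_contra hne
  have hn : 2 ≤ n := by have := D.three_le; omega
  rcases prefixLT_total hn hk hP.1 hP'.1 hne with h | h
  · have := D.pathIndex_lt_of_prefixLT hP hP' h
    omega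
  · have := D.pathIndex_lt_of_prefixLT hP' hP h
    omega

theorem prefixLT_iff {k : ℕ} (hk : k < n) {P P' : List EdgeLabel}
    (h : P ∈ followingPrefixes n q d k) (h' : P' ∈ followingPrefixes n q d k) :
    PrefixLT n P P' ↔ pathIndex q d 1 P < pathIndex q d 1 P' := by
  refine ⟨D.pathIndex_lt_of_prefixLT h h', fun hlt => ?_⟩
  have hn : 2 ≤ n := by have := D.three_le; omega
  refine (prefixLT_total hn hk h.1 h'.1 ?_).resolve_right fun hgt => ?_
  · rintro rfl
    omega
  · have := D.pathIndex_lt_of_prefixLT h' h hgt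
    omega

/-- The last edge can be read off from the position: a position above `d (k-2)` was reached along
`x_{k-1}`, any other along `y_{k-2}`. Inverting `stepIndex` gives the preceding position, and
induction continues from there. -/
theorem exists_prefix {k a : ℕ} (hk1 : 1 ≤ k) (hk : k < n) (hv : ValidIndex q d k a) :
    ∃ P ∈ followingPrefixes n q d k, pathIndex q d 1 P = a := by
  have h0 := D.q_zero
  have h1 := D.q_one
  have h2 := D.d_zero
  have h3 := D.d_one
  induction k using Nat.strong_induction_on generalizing a with
  | _ k ih =>
  have key : ∀ e c, IsEdge n e → tgt n e = k → src e < k → ValidIndex q d (src e) c →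
      Admissible q c e → stepIndex q d c e = a →
      ∃ P ∈ followingPrefixes n q d k, pathIndex q d 1 P = a := by
    rintro e c he ht hs hvc hc rfl
    obtain ⟨P, hP, rfl⟩ := ih (src e) hs (src_pos he) (by omega) hvc
    refine ⟨P ++ [e], ⟨isPath_concat.2 ⟨hP.1, he, ht⟩, follows_concat.2 ⟨hP.2, hc⟩⟩, ?_⟩
    simp [pathIndex_append]
  unfold ValidIndex at *
  rcases Nat.lt_or_ge k 2 with hk2 | hk2
  · obtain rfl : k = 1 := by omega
    refine ⟨[], ⟨rfl, trivial⟩, ?_⟩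
    simp only [pathIndex_nil]
    omega
  obtain ⟨k, rfl⟩ := Nat.exists_eq_add_of_le' hk2
  have hr := D.recurrence k hk
  rcases Nat.lt_or_ge (d k) a with had | had
  · refine key (x (k + 1)) (a - d k) ?_ ?_ ?_ ?_ ?_ ?_ <;>
      simp only [IsEdge, tgt, src, Admissible, stepIndex, Nat.add_sub_cancel]
    · omega
    · omega
    · have := D.d_pos (k + 1) (by omega) (by omega)
      omega
    · omega
    · omega
  · rcases Nat.eq_zero_or_pos k with rfl | hk0
    · refine key (y 0) 1 ?_ ?_ ?_ ?_ ?_ ?_ <;> simp only [IsEdge, tgt, src, Admissible, stepIndex]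
      · omega
      · omega
      · simp
      · simp only [zero_le, sup_of_le_right]
        omega
      · omega
      · omega
    · refine key (y k) (a + q k - 1) ?_ ?_ ?_ ?_ ?_ ?_ <;>
        simp only [IsEdge, tgt, src, Admissible, stepIndex]
      · omega
      · omega
      · omega
      · rw [max_eq_left hk0]
        have := D.q_pos k hk0 (by omega)
        omega
      · omega
      · omega

/-- There are no dead ends, since every position is at most or at least `q k`. Validity is required
only below `n`, as there is no tree at the sink. -/
theorem exists_suffix {k a : ℕ} (hk1 : 1 ≤ k) (hk : k ≤ n) (hv : k < n → ValidIndex q d k a) :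
    ∃ Q, IsPath n k Q n ∧ Follows q d a Q := by
  have hn : 2 ≤ n := by have := D.three_le; omega
  induction hm : n - k using Nat.strong_induction_on generalizing k a with
  | _ m ih =>
  subst hm
  rcases hk.eq_or_lt with rfl | hk
  · exact ⟨[], rfl, trivial⟩
  have key : ∀ e, IsEdge n e → src e = k → Admissible q a e →
      ∃ Q, IsPath n k Q n ∧ Follows q d a Q := by
    rintro e he rfl ha
    have := src_lt_tgt hn he
    obtain ⟨Q, hQ, hf⟩ := ih (n - tgt n e) (by omega) (k := tgt n e) (by omega) (tgt_le he)
      (fun ht => D.validIndex_step he ht (hv hk) ha) rfl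
    exact ⟨e :: Q, ⟨he, rfl, hQ⟩, ha, hf⟩
  rcases le_total a (q k) with ha | ha
  · exact key (x k) ⟨hk1, hk⟩ rfl ha
  · exact key (y k) hk (max_eq_left hk1) ha

theorem exists_route {k : ℕ} (hk1 : 1 ≤ k) (hk : k ≤ n) {P : List EdgeLabel}
    (hP : P ∈ followingPrefixes n q d k) : ∃ R ∈ followingRoutes n q d, P <+: R.1 := by
  obtain ⟨Q, hQ, hf⟩ := D.exists_suffix hk1 hk fun hk => D.validIndex_prefix hk hP
  exact ⟨⟨P ++ Q, isPath_append.2 ⟨k, hP.1, hQ⟩⟩, follows_append.2 ⟨hP.2, hf⟩, Q, rfl⟩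

theorem ncard_setOf_pathIndex_lt {k a : ℕ} (hk1 : 1 ≤ k) (hk : k < n)
    (ha : a ≤ q k + d k) (ha1 : 1 ≤ a) :
    {P ∈ followingPrefixes n q d k | pathIndex q d 1 P < a}.ncard + 1 = a := by
  rw [← Set.InjOn.ncard_image ((D.pathIndex_injOn hk).mono (Set.sep_subset _ _))]
  have : pathIndex q d 1 '' {P ∈ followingPrefixes n q d k | pathIndex q d 1 P < a} =
      Finset.Ico 1 a := by
    ext b
    simp only [Set.mem_image, Set.mem_ofPred_eq, Finset.coe_Ico, Set.mem_Ico]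
    constructor
    · rintro ⟨P, ⟨hP, hlt⟩, rfl⟩
      exact ⟨(D.validIndex_prefix hk hP).1, hlt⟩
    · rintro ⟨h1, h2⟩
      obtain ⟨P, hP, rfl⟩ := D.exists_prefix hk1 hk (a := b) ⟨h1, by omega⟩
      exact ⟨P, ⟨hP, h2⟩, rfl⟩
  rw [this, Set.ncard_coe_finset, Nat.card_Ico]
  omega

theorem ncard_followingPrefixes {k : ℕ} (hk1 : 1 ≤ k) (hk : k < n) :
    (followingPrefixes n q d k).ncard + 1 = q k + d k := by
  rw [← D.ncard_setOf_pathIndex_lt hk1 hk le_rfl (by have := D.q_pos k hk1 hk; omega)]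
  congr 2
  ext P
  simp only [Set.mem_ofPred_eq, iff_self_and]
  exact fun h => (D.validIndex_prefix hk h).2

theorem finite_followingPrefixes {k : ℕ} (hk : k < n) : (followingPrefixes n q d k).Finite := by
  refine Set.Finite.of_finite_image ((Set.finite_Iio (q k + d k)).subset ?_)
    (D.pathIndex_injOn hk)
  rintro _ ⟨P, hP, rfl⟩
  exact (D.validIndex_prefix hk hP).2

theorem leftIndex_eq {C : Set (Route n)} {k : ℕ} (hk1 : 1 ≤ k) (hk : k < n)
    (hC : prefixesAt C k = followingPrefixes n q d k) {P : List EdgeLabel}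
    (hP : P ∈ followingPrefixes n q d k) : leftIndex C k P = pathIndex q d 1 P := by
  have hv := D.validIndex_prefix hk hP
  unfold ValidIndex at hv
  rw [← D.ncard_setOf_pathIndex_lt hk1 hk (a := pathIndex q d 1 P) (by omega) hv.1, leftIndex, hC]
  congr 2
  ext P'
  exact and_congr_right fun h => D.prefixLT_iff hk h hP

end IsDegreeSeq

/-! ### The maximal clique of a grove -/

/-- The noncrossing tree in which `r_1` and `r_2` have degrees `q k` and `d k`. -/
def degreeTree (q d : ℕ → ℕ) (k : ℕ) : BipGraph where
  p := q k + d k - 1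
  edges := {s | s.2 = 1 ∧ 1 ≤ s.1 ∧ s.1 ≤ q k ∨ s.2 = 2 ∧ q k ≤ s.1 ∧ s.1 + 1 ≤ q k + d k}

theorem mem_degreeTree_edges {k a b : ℕ} : (a, b) ∈ (degreeTree q d k).edges ↔
    b = 1 ∧ 1 ≤ a ∧ a ≤ q k ∨ b = 2 ∧ q k ≤ a ∧ a + 1 ≤ q k + d k := Iff.rfl

theorem src_outEdge {k : ℕ} (hk : 1 ≤ k) (b : ℕ) : src (outEdge k b) = k := by
  unfold outEdge
  split_ifs
  · rfl
  · exact max_eq_left hk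

theorem isEdge_outEdge {k : ℕ} (hk : 1 ≤ k) (hkn : k < n) (b : ℕ) :
    IsEdge n (outEdge k b) := by
  unfold outEdge
  split_ifs
  · exact ⟨hk, hkn⟩
  · exact hkn

theorem exists_eq_outEdge {e : EdgeLabel} (he : 2 ≤ src e) :
    ∃ b ∈ Set.Icc 1 2, e = outEdge (src e) b := by
  cases e with
  | x k => exact ⟨1, by simp, rfl⟩
  | y k =>
    refine ⟨2, by simp, ?_⟩
    simp only [src] at *
    simp [outEdge]
    omega

namespace IsDegreeSeq

variable (D : IsDegreeSeq n q d)

include D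

theorem admissible_outEdge_iff {k a b : ℕ} (hk : 1 ≤ k) (hkn : k < n)
    (hv : ValidIndex q d k a) (hb : b ∈ Set.Icc 1 2) :
    Admissible q a (outEdge k b) ↔ (a, b) ∈ (degreeTree q d k).edges := by
  have := D.q_pos k hk hkn
  obtain ⟨h1, h2⟩ := hv
  rw [mem_degreeTree_edges]
  obtain rfl | rfl : b = 1 ∨ b = 2 := by obtain ⟨h1, h2⟩ := hb; omega
  all_goals simp [outEdge, Admissible]; omega

theorem admissible_of_src_le_one {e : EdgeLabel} (h : src e ≤ 1) : Admissible q 1 e := by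
  cases e with
  | x k =>
    simp only [src, Admissible] at *
    obtain rfl | rfl : k = 0 ∨ k = 1 := by omega
    exacts [D.q_zero.ge, D.q_one.ge]
  | y k =>
    simp only [src, Admissible] at *
    obtain rfl | rfl : k = 0 ∨ k = 1 := by omega
    exacts [D.q_zero.le, D.q_one.le]

theorem prefixesAt_followingRoutes {k : ℕ} (hk1 : 1 ≤ k) (hk : k < n) :
    prefixesAt (followingRoutes n q d) k = followingPrefixes n q d k := by
  ext P
  constructor
  · rintro ⟨hP, R, hR, Q, hQ⟩
    refine ⟨hP, ?_⟩
    have : Follows q d 1 R.1 := hR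
    rw [← hQ, follows_append] at this
    exact this.1
  · exact fun h => ⟨h.1, D.exists_route hk1 hk.le h⟩

/-- A lower prefix stays strictly lower along the common stretch. If it then leaves along `y_k`
while the higher one leaves along `x_k`, the lower position is at least `q k` and the higher at most
`q k`, a contradiction. -/
theorem isClique_followingRoutes : IsClique (followingRoutes n q d) := by
  have key : ∀ i P Q P' Q', Follows q d 1 (P ++ Q) → Follows q d 1 (P' ++ Q') →
      IsPath n 1 (P ++ Q) n → IsPath n 1 (P' ++ Q') n →
      IsPath n 1 P i → IsPath n 1 P' i → ¬ (PrefixLT n P P' ∧ SuffixLT n Q' Q) := by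
    rintro i P Q P' Q' hf hf' hQ hQ' hP hP' ⟨hlt, S, A, A', e, e', rfl, rfl, k, hk2, hk, rfl, rfl⟩
    rw [← List.append_assoc] at hf hf' hQ hQ'
    obtain ⟨c, hQ, he, hc, -⟩ := isPath_append.1 hQ
    obtain ⟨c', hQ', he', hc', -⟩ := isPath_append.1 hQ'
    rw [follows_append] at hf hf'
    have := D.pathIndex_lt_of_prefixLT (k := c) (k' := c') ⟨hQ, hf.1⟩ ⟨hQ', hf'.1⟩
      (hlt.append S)
    have h1 := hf.2.1
    have h2 := hf'.2.1
    simp only [Admissible] at h1 h2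
    omega
  intro R hR R' hR' _ i _ _ P Q P' Q' hPQ hPQ' hP hP'
  have hf : Follows q d 1 R.1 := hR
  have hf' : Follows q d 1 R'.1 := hR'
  have h := R.2
  have h' := R'.2
  rw [hPQ] at hf h
  rw [hPQ'] at hf' h'
  exact ⟨key i _ _ _ _ hf hf' h h' hP hP', key i _ _ _ _ hf' hf h' h hP' hP⟩

/-- A route that is coherent with all routes that follow a grove follows the grove. -/
theorem follows_of_coherent (R : Route n)
    (h : ∀ R' ∈ followingRoutes n q d, R ≠ R' → Coherent R R') : Follows q d 1 R.1 := by
  have key : ∀ P, P <+: R.1 → Follows q d 1 P := by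
    intro P
    induction P using List.reverseRecOn with
    | nil => exact fun _ => trivial
    | append_singleton A e ih =>
      rintro ⟨Q, hQ⟩
      have hA := ih ⟨e :: Q, by simp [← hQ]⟩
      refine follows_concat.2 ⟨hA, ?_⟩
      have hn : 2 ≤ n := by have := D.three_le; omega
      have hR := R.2
      rw [← hQ, isPath_append] at hR
      obtain ⟨c, hAe, hQc⟩ := hR
      obtain ⟨hAp, he, rfl⟩ := isPath_concat.1 hAe
      have hlt : src e < n := (src_lt_tgt hn he).trans_le (tgt_le he)
      rcases Nat.lt_or_ge (src e) 2 with hs | hs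
      · obtain hs : src e = 1 := by have := src_pos he; omega
        rw [hs] at hAp
        obtain rfl := hAp.eq_nil hn
        exact D.admissible_of_src_le_one hs.le
      by_contra hadm
      have hAF : A ∈ followingPrefixes n q d (src e) := ⟨hAp, hA⟩
      have hv := D.validIndex_prefix hlt hAF
      have hq := D.q_pos (src e) (by omega) hlt
      have hd := D.d_pos (src e) (by omega) hlt
      -- `B` arrives at the branching left vertex, so it may leave along the edge other than `e`. As
      -- `e` is forbidden after `A`, the prefix `A` lies on the wrong side of `B`, and the two
      -- routes cross here.
      obtain ⟨B, hB, hBi⟩ := D.exists_prefix (k := src e) (a := q (src e)) (by omega) hlt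
        ⟨hq, by omega⟩
      have ext : ∀ f, IsEdge n f → src f = src e → Admissible q (q (src e)) f → f ≠ e →
          ∃ R' ∈ followingRoutes n q d, R ≠ R' ∧ ∃ Q', R'.1 = B ++ f :: Q' := by
        intro f hf hfs hfa hne
        have hBf : B ++ [f] ∈ followingPrefixes n q d (tgt n f) :=
          ⟨isPath_concat.2 ⟨hfs ▸ hB.1, hf, rfl⟩, follows_concat.2 ⟨hB.2, hBi ▸ hfa⟩⟩
        obtain ⟨R', hR', Q', hQ'⟩ := D.exists_route
          ((src_pos hf).trans (src_lt_tgt hn hf).le) (tgt_le hf) hBf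
        refine ⟨R', hR', ?_, Q', by simp [← hQ']⟩
        rintro rfl
        refine hadm ?_
        have hfR : Follows q d 1 R.1 := hR'
        rw [← hQ, follows_append, follows_concat] at hfR
        exact hfR.1.2
      have hRe : R.1 = A ++ e :: Q := by simp [← hQ]
      cases e with
      | x k =>
        simp only [src, Admissible] at *
        obtain ⟨R', hR', hne, Q', hQ'⟩ := ext (y k) he.2 (max_eq_left he.1) le_rfl (by simp)
        refine (h R' hR' hne k hs hlt A _ B _ hRe hQ' hAp hB.1).2 ⟨?_, ?_⟩
        · rw [D.prefixLT_iff hlt hB hAF]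
          omega
        · exact ⟨[], Q, Q', _, _, rfl, rfl, k, hs, hlt, rfl, rfl⟩
      | y k =>
        generalize hj : src (y k) = j at *
        obtain rfl : j = k := by simp only [src] at hj; omega
        simp only [Admissible] at *
        obtain ⟨R', hR', hne, Q', hQ'⟩ := ext (x j) ⟨by omega, hlt⟩ rfl le_rfl (by simp)
        refine (h R' hR' hne j hs hlt A _ B _ hRe hQ' hAp hB.1).1 ⟨?_, ?_⟩
        · rw [D.prefixLT_iff hlt hAF hB]
          omega
        · exact ⟨[], Q', Q, _, _, rfl, rfl, j, hs, hlt, rfl, rfl⟩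
  exact key _ (List.prefix_refl _)

theorem maximal_followingRoutes : Maximal IsClique (followingRoutes n q d) := by
  refine ⟨D.isClique_followingRoutes, fun C hC hle R hR => ?_⟩
  exact D.follows_of_coherent R fun R' hR' hne => hC hR (hle hR') hne

theorem cliqueTree_followingRoutes {k : ℕ} (hk2 : 2 ≤ k) (hk : k < n) :
    cliqueTree (followingRoutes n q d) k = degreeTree q d k := by
  have hk1 : 1 ≤ k := by omega
  have hn : 2 ≤ n := by omega
  have hpre := D.prefixesAt_followingRoutes hk1 hk
  ext1
  · have := D.ncard_followingPrefixes hk1 hk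
    simp only [cliqueTree, degreeTree, hpre]
    omega
  · ext ⟨a, b⟩
    constructor
    · rintro ⟨P, hP, ha, hb, R, hR, Q, hQ⟩
      rw [hpre] at hP
      rw [D.leftIndex_eq hk1 hk hpre hP] at ha
      have hf : Follows q d 1 R.1 := hR
      rw [← hQ, follows_append, follows_concat] at hf
      rw [← D.admissible_outEdge_iff hk1 hk _ hb]
      · rw [show a = pathIndex q d 1 P from ha]
        exact hf.1.2
      · rw [show a = pathIndex q d 1 P from ha]
        exact D.validIndex_prefix hk hP
    · intro hab
      have hq := D.q_pos k hk1 hk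
      have hd := D.d_pos k hk1 hk
      have hab' := mem_degreeTree_edges.1 hab
      have hb : b ∈ Set.Icc 1 2 := by rw [Set.mem_Icc]; omega
      have hv : ValidIndex q d k a := by unfold ValidIndex; omega
      obtain ⟨P, hP, rfl⟩ := D.exists_prefix hk1 hk hv
      refine ⟨P, hpre ▸ hP, (D.leftIndex_eq hk1 hk hpre hP).symm, hb, ?_⟩
      have he := isEdge_outEdge hk1 hk b
      refine D.exists_route (k := tgt n (outEdge k b)) ?_ (tgt_le he) ⟨?_, ?_⟩
      · exact (src_pos he).trans (src_lt_tgt hn he).le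
      · exact isPath_concat.2 ⟨(src_outEdge hk1 b).symm ▸ hP.1, he, rfl⟩
      · exact follows_concat.2 ⟨hP.2, (D.admissible_outEdge_iff hk1 hk hv hb).2 hab⟩

/-- A set of routes with the given trees consists of routes that follow the trees. -/
theorem subset_followingRoutes {C : Set (Route n)}
    (hC : ∀ k, 2 ≤ k → k < n → degreeTree q d k = cliqueTree C k) :
    C ⊆ followingRoutes n q d := by
  have hn : 2 ≤ n := by have := D.three_le; omega
  -- Once the prefixes at `k` are known to be the following ones, `leftIndex` is the position, and
  -- the edge recorded in the tree is precisely admissibility.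
  have step : ∀ k, (2 ≤ k → k < n → prefixesAt C k = followingPrefixes n q d k) →
      ∀ A e, Follows q d 1 A → src e = k → ∀ R ∈ C, A ++ [e] <+: R.1 →
        Follows q d 1 (A ++ [e]) := by
    rintro k hpre A e hA rfl R hR hRe
    refine follows_concat.2 ⟨hA, ?_⟩
    obtain ⟨Q, hQ⟩ := hRe
    have hRp := R.2
    rw [← hQ, isPath_append] at hRp
    obtain ⟨c, hAe, -⟩ := hRp
    obtain ⟨hAp, he, -⟩ := isPath_concat.1 hAe
    rcases Nat.lt_or_ge (src e) 2 with hs | hs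
    · obtain hs : src e = 1 := by have := src_pos he; omega
      rw [hs] at hAp
      obtain rfl := hAp.eq_nil hn
      exact D.admissible_of_src_le_one hs.le
    have hlt : src e < n := (src_lt_tgt hn he).trans_le (tgt_le he)
    have hk1 : 1 ≤ src e := src_pos he
    have hAF : A ∈ followingPrefixes n q d (src e) := ⟨hAp, hA⟩
    obtain ⟨b, hb, heb⟩ := exists_eq_outEdge hs
    have hmem : (pathIndex q d 1 A, b) ∈ (cliqueTree C (src e)).edges := by
      refine ⟨A, hpre hs hlt ▸ hAF, (D.leftIndex_eq hk1 hlt (hpre hs hlt) hAF).symm, hb, R, hR, ?_⟩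
      exact ⟨Q, by simpa only [← heb] using hQ⟩
    rw [heb, D.admissible_outEdge_iff hk1 hlt (D.validIndex_prefix hlt hAF) hb, hC _ hs hlt]
    exact hmem
  have follows : ∀ k, (∀ j < k, 2 ≤ j → j < n → prefixesAt C j = followingPrefixes n q d j) →
      ∀ P, IsPath n 1 P k → ∀ R ∈ C, P <+: R.1 → Follows q d 1 P := by
    intro k hk P
    induction P using List.reverseRecOn generalizing k with
    | nil => exact fun _ _ _ _ => trivial
    | append_singleton A e ih =>
      intro hP R hR hRe
      obtain ⟨hAp, he, rfl⟩ := isPath_concat.1 hP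
      have hlt := src_lt_tgt hn he
      refine step (src e) (hk _ hlt) A e ?_ rfl R hR hRe
      exact ih (src e) (fun j hj => hk j (hj.trans hlt)) hAp R hR
        ((List.prefix_append _ _).trans hRe)
  have main : ∀ k, 2 ≤ k → k < n → prefixesAt C k = followingPrefixes n q d k := by
    intro k
    induction k using Nat.strong_induction_on with
    | _ k ih =>
    intro hk2 hk
    -- Only one inclusion comes from following the rules at earlier vertices; equality holds because
    -- the number of left vertices prescribes the number of prefixes.
    refine Set.eq_of_subset_of_ncard_le ?_ ?_ (D.finite_followingPrefixes hk)
    · rintro P ⟨hP, R, hR, hRP⟩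
      exact ⟨hP, follows k ih P hP R hR hRP⟩
    · have h1 := D.ncard_followingPrefixes (by omega) hk
      have h2 : q k + d k - 1 = (prefixesAt C k).ncard := congrArg BipGraph.p (hC k hk2 hk)
      omega
  intro R hR
  exact follows n (fun j _ => main j) R.1 R.2 R hR (List.prefix_refl _)

end IsDegreeSeq

/-! ### Noncrossing trees with two right vertices -/

theorem mem_of_reachable {V : Type*} {G : SimpleGraph V} {S : Set V}
    (hS : ∀ u v, G.Adj u v → u ∈ S → v ∈ S) {u v : V} (h : G.Reachable u v) (hu : u ∈ S) :
    v ∈ S := by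
  obtain ⟨w⟩ := h
  induction w with
  | nil => exact hu
  | cons hadj _ ih => exact ih (hS _ _ hadj hu)

namespace BipGraph

variable {T : BipGraph}

theorem graph_adj_inl_inr {a : Set.Icc 1 T.p} {b : Set.Icc 1 2} :
    T.graph.Adj (Sum.inl a) (Sum.inr b) ↔ ((a : ℕ), (b : ℕ)) ∈ T.edges := by
  rw [graph, SimpleGraph.fromRel_adj]
  constructor
  · rintro ⟨-, ⟨a', b', ha, hb, h⟩ | ⟨a', b', ha, -, -⟩⟩
    · rwa [Sum.inl.inj ha, Sum.inr.inj hb]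
    · simp at ha
  · exact fun h => ⟨by simp, .inl ⟨a, b, rfl, rfl, h⟩⟩

theorem not_graph_adj_inl_inl {a a' : Set.Icc 1 T.p} :
    ¬ T.graph.Adj (Sum.inl a) (Sum.inl a') := by
  simp [graph]

theorem not_graph_adj_inr_inr {b b' : Set.Icc 1 2} :
    ¬ T.graph.Adj (Sum.inr b) (Sum.inr b') := by
  simp [graph]

/-- Connectedness gives every left vertex an edge and provides one, `l_j`, joined to both right
vertices. Noncrossing with the two edges at `l_j` then decides every other edge. -/
theorem IsNoncrossingTree.exists_edges_iff (h : T.IsNoncrossingTree) :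
    ∃ j, 1 ≤ j ∧ j ≤ T.p ∧ ∀ a b, (a, b) ∈ T.edges ↔
      b = 1 ∧ 1 ≤ a ∧ a ≤ j ∨ b = 2 ∧ j ≤ a ∧ a ≤ T.p := by
  have conn := h.isTree.connected.preconnected
  have left : ∀ a, 1 ≤ a → a ≤ T.p → (a, 1) ∈ T.edges ∨ (a, 2) ∈ T.edges := by
    intro a h1 h2
    by_contra hne
    have := mem_of_reachable (S := {Sum.inl ⟨a, h1, h2⟩}) ?_
      (conn (Sum.inl ⟨a, h1, h2⟩) (Sum.inr ⟨1, by simp⟩))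
      (Set.mem_singleton _)
    · simp at this
    · rintro _ (v | ⟨b, hb⟩) hadj rfl
      · exact absurd hadj not_graph_adj_inl_inl
      · rw [graph_adj_inl_inr] at hadj
        obtain rfl | rfl : b = 1 ∨ b = 2 := by obtain ⟨h1, h2⟩ := hb; omega
        · exact absurd (Or.inl hadj) hne
        · exact absurd (Or.inr hadj) hne
  have double : ∃ j, (j, 1) ∈ T.edges ∧ (j, 2) ∈ T.edges := by
    by_contra! hne
    -- Without a doubly joined left vertex, `r_1` and its neighbours would be closed under
    -- adjacency, yet miss `r_2`.
    let S : Set (Set.Icc 1 T.p ⊕ Set.Icc 1 2) :=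
      {v | v = Sum.inr ⟨1, by simp⟩ ∨ ∃ a, v = Sum.inl a ∧ ((a : ℕ), 1) ∈ T.edges}
    have := mem_of_reachable (S := S) ?_
      (conn (Sum.inr ⟨1, by simp⟩) (Sum.inr ⟨2, by simp⟩)) (.inl rfl)
    · simp [S] at this
    · rintro u v hadj (rfl | ⟨a, rfl, ha⟩)
      · rcases v with a | b
        · exact .inr ⟨a, rfl, graph_adj_inl_inr.1 hadj.symm⟩
        · exact absurd hadj not_graph_adj_inr_inr
      · rcases v with a' | ⟨b, hb⟩
        · exact absurd hadj not_graph_adj_inl_inl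
        · rw [graph_adj_inl_inr] at hadj
          obtain rfl | rfl : b = 1 ∨ b = 2 := by obtain ⟨h1, h2⟩ := hb; omega
          · exact .inl rfl
          · exact absurd hadj (hne _ ha)
  obtain ⟨j, hj1, hj2⟩ := double
  have hj := (h.mem_Icc _ _ hj1).1
  refine ⟨j, hj.1, hj.2, fun a b => ⟨fun hab => ?_, ?_⟩⟩
  · obtain ⟨⟨ha1, ha2⟩, hb1, hb2⟩ := h.mem_Icc a b hab
    rcases lt_trichotomy a j with haj | rfl | haj
    · have := h.noncrossing _ _ _ _ hab hj1 haj
      omega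
    · omega
    · have := h.noncrossing _ _ _ _ hj2 hab haj
      omega
  · rintro (⟨rfl, h1, h2⟩ | ⟨rfl, h1, h2⟩)
    · rcases h2.eq_or_lt with rfl | h2
      · exact hj1
      · refine (left a h1 (h2.le.trans hj.2)).resolve_right fun h3 => ?_
        have := h.noncrossing _ _ _ _ h3 hj1 h2
        omega
    · rcases h1.eq_or_lt with rfl | h1
      · exact hj2
      · refine (left a (hj.1.trans h1.le) h2).resolve_left fun h3 => ?_
        have := h.noncrossing _ _ _ _ hj2 h3 h1
        omega

theorem IsNoncrossingTree.rightDeg_spec (h : T.IsNoncrossingTree) :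
    1 ≤ T.rightDeg 1 ∧ 1 ≤ T.rightDeg 2 ∧ T.p + 1 = T.rightDeg 1 + T.rightDeg 2 ∧
      ∀ a b, (a, b) ∈ T.edges ↔ b = 1 ∧ 1 ≤ a ∧ a ≤ T.rightDeg 1 ∨
        b = 2 ∧ T.rightDeg 1 ≤ a ∧ a + 1 ≤ T.rightDeg 1 + T.rightDeg 2 := by
  obtain ⟨j, h1, h2, hj⟩ := h.exists_edges_iff
  have e1 : T.rightDeg 1 = j := by
    have : {a | (a, 1) ∈ T.edges} = Finset.Icc 1 j := by
      ext a
      simp [hj]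
    rw [rightDeg, this, Set.ncard_coe_finset, Nat.card_Icc]
    omega
  have e2 : T.rightDeg 2 = T.p + 1 - j := by
    have : {a | (a, 2) ∈ T.edges} = Finset.Icc j T.p := by
      ext a
      simp [hj]
    rw [rightDeg, this, Set.ncard_coe_finset, Nat.card_Icc]
  rw [e1, e2]
  refine ⟨h1, by omega, by omega, fun a b => ?_⟩
  rw [hj]
  omega

end BipGraph

/-! ### The degrees of a grove -/

namespace Grove

variable {n : ℕ} (Γ : Grove n)

theorem isDegreeSeq (hn : 3 ≤ n) : IsDegreeSeq n (degX Γ.tree) (degY Γ.tree) where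
  three_le := hn
  q_zero := rfl
  q_one := rfl
  d_zero := rfl
  d_one := rfl
  q_pos k _ hk := by
    unfold degX
    split_ifs
    · exact le_rfl
    · exact (Γ.noncrossingTree k (by omega) hk).rightDeg_spec.1
  d_pos k _ hk := by
    unfold degY
    split_ifs
    · exact le_rfl
    · exact (Γ.noncrossingTree k (by omega) hk).rightDeg_spec.2.1
  recurrence k hk := by
    have h1 := (Γ.noncrossingTree (k + 2) (by omega) hk).rightDeg_spec.2.2.1
    have h2 : (Γ.tree (k + 2)).p = degX Γ.tree (k + 1) + degY Γ.tree k :=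
      Γ.leftCount (k + 2) (by omega) hk
    rw [← h2, h1]
    simp [degX, degY]

theorem tree_eq {k : ℕ} (hk2 : 2 ≤ k) (hk : k < n) :
    Γ.tree k = degreeTree (degX Γ.tree) (degY Γ.tree) k := by
  obtain ⟨-, -, hp, h⟩ := (Γ.noncrossingTree k hk2 hk).rightDeg_spec
  have e1 : degX Γ.tree k = (Γ.tree k).rightDeg 1 := if_neg (by omega)
  have e2 : degY Γ.tree k = (Γ.tree k).rightDeg 2 := if_neg (by omega)
  ext1
  · simp only [degreeTree]
    omega
  · ext ⟨a, b⟩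
    rw [h, mem_degreeTree_edges, e1, e2]

/-- The maximal clique of a grove. -/
def maximalClique (hn : 3 ≤ n) : MaximalClique n :=
  ⟨followingRoutes n (degX Γ.tree) (degY Γ.tree), (Γ.isDegreeSeq hn).maximal_followingRoutes⟩

/-- A clique with the trees of `Γ` lies in the clique of all following routes, so its maximality
forces equality. -/
theorem corresponds_iff (hn : 3 ≤ n) (C : MaximalClique n) :
    Corresponds C Γ ↔ C = Γ.maximalClique hn := by
  constructor
  · intro h
    refine Subtype.ext ?_
    refine C.2.eq_of_subset (Γ.isDegreeSeq hn).isClique_followingRoutes ?_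
    exact (Γ.isDegreeSeq hn).subset_followingRoutes fun k hk2 hk =>
      (Γ.tree_eq hk2 hk).symm.trans (h k hk2 hk)
  · rintro rfl k hk2 hk
    exact (Γ.tree_eq hk2 hk).trans ((Γ.isDegreeSeq hn).cliqueTree_followingRoutes hk2 hk).symm

end Grove

/-! ### Unique suffixes -/

/-- There is exactly one suffix at `k` that follows the grove from the left vertex `l_a`. -/
def UniqueSuffix (n : ℕ) (q d : ℕ → ℕ) (k a : ℕ) : Prop :=
  ∃! Q, IsPath n k Q n ∧ Follows q d a Q

theorem uniqueSuffix_self (hn : 2 ≤ n) (a : ℕ) : UniqueSuffix n q d n a :=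
  ⟨[], ⟨rfl, trivial⟩, fun _ h => h.1.eq_nil hn⟩

theorem uniqueSuffix_iff_of_unique_edge {k a : ℕ} (hk : k < n) {e : EdgeLabel} (he : IsEdge n e)
    (hs : src e = k) (ha : Admissible q a e)
    (huniq : ∀ f, IsEdge n f → src f = k → Admissible q a f → f = e) :
    UniqueSuffix n q d k a ↔ UniqueSuffix n q d (tgt n e) (stepIndex q d a e) := by
  constructor
  · rintro ⟨Q, ⟨hQ, hf⟩, hu⟩
    cases Q with
    | nil => exact absurd hQ hk.ne
    | cons f Q =>
      obtain rfl := huniq f hQ.1 hQ.2.1 hf.1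
      refine ⟨Q, ⟨hQ.2.2, hf.2⟩, fun Q' hQ' => ?_⟩
      exact (List.cons.inj (hu (f :: Q') ⟨⟨he, hs, hQ'.1⟩, ha, hQ'.2⟩)).2
  · rintro ⟨Q, ⟨hQ, hf⟩, hu⟩
    refine ⟨e :: Q, ⟨⟨he, hs, hQ⟩, ha, hf⟩, ?_⟩
    rintro Q' ⟨hQ', hf'⟩
    cases Q' with
    | nil => exact absurd hQ' hk.ne
    | cons f Q' =>
      obtain rfl := huniq f hQ'.1 hQ'.2.1 hf'.1
      rw [hu Q' ⟨hQ'.2.2, hf'.2⟩]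

theorem eq_x_or_eq_y_of_src {k : ℕ} (hk : 2 ≤ k) {f : EdgeLabel} (hs : src f = k) :
    f = x k ∨ f = y k := by
  cases f <;> simp only [src, x.injEq, y.injEq, reduceCtorEq, or_false, false_or] at * <;> omega

theorem uniqueSuffix_iff_of_lt {k a : ℕ} (hk2 : 2 ≤ k) (hk : k < n) (ha : a < q k) :
    UniqueSuffix n q d k a ↔ UniqueSuffix n q d (k + 1) (d (k - 1) + a) := by
  refine uniqueSuffix_iff_of_unique_edge hk (e := x k) ⟨by omega, hk⟩ rfl ha.le fun f _ hs hf => ?_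
  rcases eq_x_or_eq_y_of_src hk2 hs with rfl | rfl
  · rfl
  · exact absurd ha (not_lt.2 hf)

theorem uniqueSuffix_iff_of_gt {k a : ℕ} (hk2 : 2 ≤ k) (hk : k < n) (ha : q k < a) :
    UniqueSuffix n q d k a ↔ UniqueSuffix n q d (min (k + 2) n) (a + 1 - q k) := by
  refine uniqueSuffix_iff_of_unique_edge hk (e := y k) hk (max_eq_left (by omega)) ha.le
    fun f _ hs hf => ?_
  rcases eq_x_or_eq_y_of_src hk2 hs with rfl | rfl
  · exact absurd ha (not_lt.2 hf)
  · rfl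

namespace IsDegreeSeq

/-- At the branching vertex both outgoing edges are admissible, and each extends to the sink. -/
theorem not_uniqueSuffix (D : IsDegreeSeq n q d) {k : ℕ} (hk2 : 2 ≤ k) (hk : k < n) :
    ¬ UniqueSuffix n q d k (q k) := by
  rintro ⟨Q, -, hu⟩
  have hn : 2 ≤ n := by omega
  have ext : ∀ f, IsEdge n f → src f = k → Admissible q (q k) f →
      ∃ Q', IsPath n k (f :: Q') n ∧ Follows q d (q k) (f :: Q') := by
    rintro f hf rfl hfa
    have hq := D.q_pos (src f) (by omega) hk
    have hd := D.d_pos (src f) (by omega) hk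
    obtain ⟨Q', hQ', hfQ'⟩ := D.exists_suffix ((src_pos hf).trans (src_lt_tgt hn hf).le)
      (tgt_le hf) (a := stepIndex q d (q (src f)) f)
      fun ht => D.validIndex_step hf ht ⟨hq, by omega⟩ hfa
    exact ⟨Q', ⟨hf, rfl, hQ'⟩, hfa, hfQ'⟩
  obtain ⟨Q1, h1⟩ := ext (x k) ⟨by omega, hk⟩ rfl le_rfl
  obtain ⟨Q2, h2⟩ := ext (y k) hk (max_eq_left (by omega)) le_rfl
  simpa using (hu _ h1).trans (hu _ h2).symm

end IsDegreeSeq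

/-! ### Tracking -/

section Tracking

variable {γ : ℕ → BipGraph} (hγ : ∀ k, 2 ≤ k → k < n → γ k = degreeTree (degX γ) (degY γ) k)

include hγ

theorem topLeft_one {k : ℕ} (hk2 : 2 ≤ k) (hk : k < n) (hq : 1 ≤ degX γ k) :
    (γ k).topLeft 1 = degX γ k := by
  refine IsGreatest.csSup_eq ⟨?_, fun a ha => ?_⟩
  · rw [hγ k hk2 hk]
    exact .inl ⟨rfl, hq, le_rfl⟩
  · rw [hγ k hk2 hk] at ha
    have := mem_degreeTree_edges.1 ha
    omega

theorem arrival_eq {k a b : ℕ} (hk2 : 2 ≤ k) (hk : k < n) (hab : (a, b) ∈ (γ k).edges) :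
    arrival γ k a b = stepIndex (degX γ) (degY γ) a (outEdge k b) := by
  rw [hγ k hk2 hk, mem_degreeTree_edges] at hab
  rcases hab with ⟨rfl, h1, h2⟩ | ⟨rfl, h1, h2⟩
  · have : {a' | a' ≤ a ∧ (a', 1) ∈ (γ k).edges} = Finset.Icc 1 a := by
      ext a'
      simp only [Set.mem_ofPred_eq, hγ k hk2 hk, mem_degreeTree_edges, Finset.coe_Icc, Set.mem_Icc,
        OfNat.one_ne_ofNat, false_and, true_and, or_false]
      omega
    simp [arrival, BipGraph.rank, this, outEdge, stepIndex, Set.ncard_coe_finset,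
      -Finset.coe_Icc]
  · have : {a' | a' ≤ a ∧ (a', 2) ∈ (γ k).edges} = Finset.Icc (degX γ k) a := by
      ext a'
      simp only [Set.mem_ofPred_eq, hγ k hk2 hk, mem_degreeTree_edges, Finset.coe_Icc, Set.mem_Icc,
        OfNat.ofNat_ne_one, false_and, true_and, false_or]
      omega
    simp [arrival, BipGraph.rank, this, outEdge, stepIndex, Set.ncard_coe_finset,
      -Finset.coe_Icc]

variable (D : IsDegreeSeq n (degX γ) (degY γ))

include D

/-- Both sides are decided by the same walk: a singly joined left vertex passes the question on to
its only edge, a branching one makes both sides false, and the sink makes both true. -/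
theorem trackable_iff {k a b : ℕ} (hk2 : 2 ≤ k) (hk : k < n) (hab : (a, b) ∈ (γ k).edges) :
    Trackable n γ k a b ↔ UniqueSuffix n (degX γ) (degY γ) (tgt n (outEdge k b))
      (stepIndex (degX γ) (degY γ) a (outEdge k b)) := by
  have hn : 2 ≤ n := by omega
  induction hm : n - k using Nat.strong_induction_on generalizing k a b with
  | _ m ih =>
  subst hm
  have hk1 : 1 ≤ k := by omega
  have he : IsEdge n (outEdge k b) := isEdge_outEdge hk1 hk b
  have hlt : k < tgt n (outEdge k b) := by
    have := src_lt_tgt hn he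
    rwa [src_outEdge hk1] at this
  rcases (tgt_le he).eq_or_lt with ht | ht
  · rw [ht]
    exact iff_of_true (.done k a b hab ht) (uniqueSuffix_self hn _)
  have hab' := hab
  rw [hγ k hk2 hk, mem_degreeTree_edges] at hab'
  have hq := D.q_pos k hk1 hk
  have hv : ValidIndex (degX γ) (degY γ) k a := by
    have := D.d_pos k hk1 hk
    unfold ValidIndex
    omega
  have hadm : Admissible (degX γ) a (outEdge k b) := by
    rw [D.admissible_outEdge_iff hk1 hk hv (by rw [Set.mem_Icc]; omega), ← hγ k hk2 hk]
    exact hab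
  have hv' := D.validIndex_step he ht ((src_outEdge hk1 b).symm ▸ hv) hadm
  have harr := arrival_eq hγ hk2 hk hab
  generalize hj : tgt n (outEdge k b) = j at *
  generalize stepIndex (degX γ) (degY γ) a (outEdge k b) = a' at *
  have hj2 : 2 ≤ j := by omega
  obtain ⟨hv1, hv2⟩ := hv'
  have hedges : ∀ c, (a', c) ∈ (γ j).edges ↔ c = 1 ∧ 1 ≤ a' ∧ a' ≤ degX γ j ∨
      c = 2 ∧ degX γ j ≤ a' ∧ a' + 1 ≤ degX γ j + degY γ j := fun c => by
    rw [hγ j hj2 ht, mem_degreeTree_edges]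
  constructor
  · intro h
    cases h with
    | done _ _ _ _ h => omega
    | step _ _ _ j' c _ h1 _ hc htr =>
      obtain rfl : j = j' := hj.symm.trans h1
      rw [harr] at hc htr
      have hac : (a', c) ∈ (γ j).edges := (hc c).2 rfl
      replace htr := (ih (n - j) (by omega) hj2 ht hac rfl).1 htr
      rcases (hedges c).1 hac with ⟨rfl, h1, h2⟩ | ⟨rfl, h1, h2⟩
      · rw [uniqueSuffix_iff_of_lt hj2 ht]
        · exact htr
        · by_contra hlt
          have := (hc 2).1 ((hedges 2).2 (by omega))
          omega
      · rw [uniqueSuffix_iff_of_gt hj2 ht]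
        · exact htr
        · by_contra hlt
          have := (hc 1).1 ((hedges 1).2 (by omega))
          omega
  · intro h
    have main : ∀ c, (∀ c', (a', c') ∈ (γ j).edges ↔ c' = c) →
        UniqueSuffix n (degX γ) (degY γ) (tgt n (outEdge j c))
          (stepIndex (degX γ) (degY γ) a' (outEdge j c)) → Trackable n γ k a b := by
      intro c hc hu
      have := (ih (n - j) (by omega) hj2 ht ((hc c).2 rfl) rfl).2 hu
      rw [← harr] at hc this
      exact .step k a b j c hab hj ht hc this
    rcases lt_trichotomy a' (degX γ j) with hlt' | heq | hgt
    · refine main 1 (fun c' => ?_) ((uniqueSuffix_iff_of_lt hj2 ht hlt').1 h)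
      rw [hedges]
      omega
    · rw [heq] at h
      exact absurd h (D.not_uniqueSuffix hj2 ht)
    · refine main 2 (fun c' => ?_) ((uniqueSuffix_iff_of_gt hj2 ht hgt).1 h)
      rw [hedges]
      omega

/-- An offset measures the distance to the branching left vertex, so it is zero exactly there. The
walk passes to the next tree otherwise, and the entries `none` for skipped vertices do not count as
zeroes. -/
theorem zero_notMem_offsetsFrom {m k a : ℕ} (hk2 : 2 ≤ k) (hm : m + k = n)
    (hv : k < n → ValidIndex (degX γ) (degY γ) k a) :
    some 0 ∉ offsetsFrom γ m k a ↔ UniqueSuffix n (degX γ) (degY γ) k a := by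
  have hn : 2 ≤ n := by omega
  induction m using Nat.strong_induction_on generalizing k a with
  | _ m ih =>
  cases m with
  | zero =>
    obtain rfl : k = n := by omega
    exact iff_of_true (by simp [offsetsFrom]) (uniqueSuffix_self hn _)
  | succ m =>
  have hk : k < n := by omega
  have hk1 : 1 ≤ k := by omega
  have hvk := hv hk
  have hstep : ∀ b ∈ Set.Icc 1 2, (a, b) ∈ (γ k).edges → tgt n (outEdge k b) < n →
      ValidIndex (degX γ) (degY γ) (tgt n (outEdge k b)) (arrival γ k a b) := by
    intro b hb hab ht
    rw [arrival_eq hγ hk2 hk hab]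
    refine D.validIndex_step (isEdge_outEdge hk1 hk b) ht ((src_outEdge hk1 b).symm ▸ hvk) ?_
    rwa [D.admissible_outEdge_iff hk1 hk hvk hb, ← hγ k hk2 hk]
  obtain ⟨hv1, hv2⟩ := hvk
  have hedges : ∀ a c, (a, c) ∈ (γ k).edges ↔ c = 1 ∧ 1 ≤ a ∧ a ≤ degX γ k ∨
      c = 2 ∧ degX γ k ≤ a ∧ a + 1 ≤ degX γ k + degY γ k := fun a c => by
    rw [hγ k hk2 hk, mem_degreeTree_edges]
  rw [offsetsFrom.eq_def]
  dsimp only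
  rcases lt_trichotomy a (degX γ k) with hlt | heq | hgt
  · have h1 : (a, 1) ∈ (γ k).edges := (hedges a 1).2 (by omega)
    have h2 : (a, 2) ∉ (γ k).edges := fun h => by have := (hedges a 2).1 h; omega
    have hfin : {a' | a < a' ∧ (a', 1) ∈ (γ k).edges}.Finite :=
      (Set.finite_Iic (degX γ k)).subset fun a' ha' => by
        have := (hedges a' 1).1 ha'.2
        rw [Set.mem_Iic]
        omega
    -- The edge at the branching left vertex is among those counted, so the offset is nonzero; the
    -- same witness serves on the other side.
    have hmem : degX γ k ∈ {a' | a < a' ∧ (a', 1) ∈ (γ k).edges} :=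
      ⟨hlt, (hedges _ _).2 (by omega)⟩
    have hne : ({a' | a < a' ∧ (a', 1) ∈ (γ k).edges}.ncard : ℤ) ≠ 0 :=
      Int.natCast_ne_zero.2 (Set.ncard_ne_zero_of_mem hmem hfin)
    have hih := ih m (by omega) (k := k + 1) (by omega) (by omega) (hstep 1 (by simp) h1)
    rw [if_neg (fun h => h2 h.2), if_pos h1, uniqueSuffix_iff_of_lt hk2 hk hlt,
      ← show arrival γ k a 1 = degY γ (k - 1) + a from arrival_eq hγ hk2 hk h1]
    refine Iff.trans (not_congr ?_) hih
    rw [List.mem_cons]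
    exact or_iff_right fun h => hne (by have := Option.some.inj h; omega)
  · rw [if_pos ⟨(hedges _ _).2 (by omega), (hedges _ _).2 (by omega)⟩]
    refine iff_of_false (by simp) ?_
    rw [heq]
    exact D.not_uniqueSuffix hk2 hk
  · have h1 : (a, 1) ∉ (γ k).edges := fun h => by have := (hedges a 1).1 h; omega
    have h2 : (a, 2) ∈ (γ k).edges := (hedges a 2).2 (by omega)
    have hfin : {a' | a' < a ∧ (a', 2) ∈ (γ k).edges}.Finite :=
      (Set.finite_Iio a).subset fun a' ha' => ha'.1
    have hmem : degX γ k ∈ {a' | a' < a ∧ (a', 2) ∈ (γ k).edges} :=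
      ⟨hgt, (hedges _ _).2 (by omega)⟩
    have hne : ({a' | a' < a ∧ (a', 2) ∈ (γ k).edges}.ncard : ℤ) ≠ 0 :=
      Int.natCast_ne_zero.2 (Set.ncard_ne_zero_of_mem hmem hfin)
    have harr : arrival γ k a 2 = a + 1 - degX γ k := arrival_eq hγ hk2 hk h2
    rw [if_neg (fun h => h1 h.1), if_neg h1, uniqueSuffix_iff_of_gt hk2 hk hgt, ← harr]
    have hne0 : some (0 : ℤ) ≠ some ({a' | a' < a ∧ (a', 2) ∈ (γ k).edges}.ncard : ℤ) :=
      fun h => hne (Option.some.inj h).symm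
    cases m with
    | zero =>
      rw [min_eq_right (by omega)]
      refine iff_of_true ?_ (uniqueSuffix_self hn _)
      simpa only [List.mem_singleton] using hne0
    | succ m =>
      have hmin : min (k + 2) n = k + 2 := min_eq_left (by omega)
      have hih := ih m (by omega) (k := k + 2) (a := arrival γ k a 2) (by omega) (by omega) ?_
      · rw [hmin]
        refine Iff.trans (not_congr ?_) hih
        rw [List.mem_cons, List.mem_cons]
        simp only [hne0, reduceCtorEq, false_or]
      · intro h
        have := hstep 2 (by simp) h2
        simp only [outEdge, tgt, OfNat.ofNat_ne_one, if_false, hmin] at this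
        exact this h

end Tracking

/-! ### Vertices of the simplices -/

theorem routeFlow_injective {n : ℕ} (hn : 2 ≤ n) : Function.Injective (routeFlow (n := n)) := by
  intro R R' h
  refine Subtype.ext (R.2.eq_of_mem_iff hn R'.2 fun e => ?_)
  by_cases he : IsEdge n e
  · have := congrFun h ⟨e, he⟩
    simp only [routeFlow] at this
    by_cases h1 : e ∈ R.1 <;> by_cases h2 : e ∈ R'.1 <;> simp_all
  · exact iff_of_false (fun h => he (R.2.src_mem hn h).1) fun h => he (R'.2.src_mem hn h).1

theorem routeFlow_mem_Icc {n : ℕ} (R : Route n) : routeFlow R ∈ Set.Icc (0 : Edge n → ℝ) 1 := by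
  constructor <;> intro e <;> simp only [routeFlow] <;> split_ifs <;> simp

/-- A vector with entries `0` and `1` is a vertex of the unit cube. -/
theorem routeFlow_mem_extremePoints {n : ℕ} (R : Route n) :
    routeFlow R ∈ (Set.Icc (0 : Edge n → ℝ) 1).extremePoints ℝ := by
  refine mem_extremePoints.2 ⟨routeFlow_mem_Icc R, ?_⟩
  rintro u ⟨hu0, hu1⟩ v ⟨hv0, hv1⟩ ⟨s, t, hs, ht, hst, h⟩
  have key : ∀ e, u e = routeFlow R e ∧ v e = routeFlow R e := by
    intro e
    have he : s * u e + t * v e = routeFlow R e := congrFun h e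
    have h1 : 0 ≤ u e := hu0 e
    have h2 : u e ≤ 1 := hu1 e
    have h3 : 0 ≤ v e := hv0 e
    have h4 : v e ≤ 1 := hv1 e
    have h5 := mul_nonneg hs.le h1
    have h6 := mul_nonneg ht.le h3
    have h7 := mul_nonneg hs.le (sub_nonneg.2 h2)
    have h8 := mul_nonneg ht.le (sub_nonneg.2 h4)
    simp only [routeFlow] at *
    split_ifs at he ⊢
    · have e1 : s * (1 - u e) = 0 := by linarith
      have e2 : t * (1 - v e) = 0 := by linarith
      have e3 := (mul_eq_zero.1 e1).resolve_left hs.ne'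
      have e4 := (mul_eq_zero.1 e2).resolve_left ht.ne'
      constructor <;> linarith
    · have e1 : s * u e = 0 := by linarith
      have e2 : t * v e = 0 := by linarith
      exact ⟨(mul_eq_zero.1 e1).resolve_left hs.ne', (mul_eq_zero.1 e2).resolve_left ht.ne'⟩
  exact ⟨funext fun e => (key e).1, funext fun e => (key e).2⟩

/-- The hull lies in the unit cube, and a vertex of the cube remains extreme in any subset
containing it. Thus no route is lost as a vertex. -/
theorem extremePoints_cliqueSimplex {n : ℕ} (C : Set (Route n)) :
    (cliqueSimplex C).extremePoints ℝ = routeFlow '' C := by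
  refine extremePoints_convexHull_subset.antisymm ?_
  rintro _ ⟨R, hR, rfl⟩
  refine inter_extremePoints_subset_extremePoints_of_subset (convexHull_min ?_ (convex_Icc 0 1))
    ⟨subset_convexHull ℝ _ ⟨R, hR, rfl⟩, routeFlow_mem_extremePoints R⟩
  rintro _ ⟨R', -, rfl⟩
  exact routeFlow_mem_Icc R'

theorem ncard_eq_one_iff_existsUnique {α : Type*} {s : Set α} :
    s.ncard = 1 ↔ ∃! a, a ∈ s := by
  rw [Set.ncard_eq_one]
  constructor
  · rintro ⟨a, rfl⟩
    exact ⟨a, rfl, fun _ h => h⟩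
  · rintro ⟨a, ha, h⟩
    exact ⟨a, Set.eq_singleton_iff_unique_mem.2 ⟨ha, h⟩⟩

theorem dualGraph_adj_iff {n : ℕ} (hn : 2 ≤ n) (C C' : MaximalClique n) :
    (dualGraph n).Adj C.simplex C'.simplex ↔
      (∃! R, R ∈ C.1 \ C'.1) ∧ ∃! R, R ∈ C'.1 \ C.1 := by
  have h := routeFlow_injective hn
  simp only [← ncard_eq_one_iff_existsUnique, ← Set.ncard_image_of_injective _ h,
    Set.image_sdiff h, ← extremePoints_cliqueSimplex]
  rfl

/-! ### Elementary moves -/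

/-- The effect of the elementary move `m_i^+` on the degrees of a grove. -/
structure IsDegreeMove (n i : ℕ) (q d q' d' : ℕ → ℕ) : Prop where
  two_le : 2 ≤ i
  lt : i < n
  q_self : q i = q' i + 1
  d_self : d' i = d i + 1
  q_succ : i + 1 < n → q' (i + 1) = q (i + 1)
  d_succ : i + 1 < n → d (i + 1) = d' (i + 1) + 1
  q_add_two : i + 2 < n → q' (i + 2) = q (i + 2) + 1
  d_add_two : i + 2 < n → d' (i + 2) = d (i + 2)
  q_other : ∀ k, k < n → k ≠ i → k ≠ i + 1 → k ≠ i + 2 → q' k = q k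
  d_other : ∀ k, k < n → k ≠ i → k ≠ i + 1 → k ≠ i + 2 → d' k = d k

theorem IsPlusMove.isDegreeMove {n i : ℕ} {Γ Γ' : Grove n} (h : IsPlusMove i Γ Γ') :
    IsDegreeMove n i (degX Γ.tree) (degY Γ.tree) (degX Γ'.tree) (degY Γ'.tree) := by
  have h2 := h.two_le
  have hi := h.lt
  have D := Γ.isDegreeSeq (by omega)
  have D' := Γ'.isDegreeSeq (by omega)
  have self : degX Γ.tree i = degX Γ'.tree i + 1 ∧ degY Γ'.tree i = degY Γ.tree i + 1 := by
    obtain ⟨j, hj, hj1, hj2, ht⟩ := h.tree_i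
    rw [Γ.tree_eq h2 hi] at hj1 hj2 ht
    rw [Γ'.tree_eq h2 hi] at ht
    have hp : degX Γ'.tree i + degY Γ'.tree i - 1 = degX Γ.tree i + degY Γ.tree i - 1 :=
      congrArg BipGraph.p ht
    have he : ∀ a b, (a, b) ∈ (degreeTree (degX Γ'.tree) (degY Γ'.tree) i).edges ↔
        (a = j - 1 ∧ b = 2) ∨
          ((a, b) ∈ (degreeTree (degX Γ.tree) (degY Γ.tree) i).edges ∧ ¬ (a = j ∧ b = 1)) := by
      intro a b
      rw [ht]
      simp
    simp only [mem_degreeTree_edges] at hj1 hj2 he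
    -- Testing the edge to `r_1` at the old and new candidates for the top position identifies `q'
    -- i` with `j - 1`; the unchanged number of left vertices then gives `d' i`.
    have e1 := he (degX Γ'.tree i) 1
    have e2 := he (j - 1) 1
    have := D.q_pos i (by omega) hi
    have := D'.q_pos i (by omega) hi
    have := D'.d_pos i (by omega) hi
    omega
  have succ (h1 : i + 1 < n) : degX Γ'.tree (i + 1) = degX Γ.tree (i + 1) ∧
      degY Γ.tree (i + 1) = degY Γ'.tree (i + 1) + 1 := by
    obtain ⟨hnd, ht⟩ := h.tree_succ h1
    rw [Γ.tree_eq (by omega) h1] at hnd ht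
    rw [Γ'.tree_eq (by omega) h1] at ht
    have hp : degX Γ'.tree (i + 1) + degY Γ'.tree (i + 1) - 1 =
      degX Γ.tree (i + 1) + degY Γ.tree (i + 1) - 1 - 1 := congrArg BipGraph.p ht
    have he : ∀ a b, (a, b) ∈ (degreeTree (degX Γ'.tree) (degY Γ'.tree) (i + 1)).edges ↔
        (a, b) ∈ (degreeTree (degX Γ.tree) (degY Γ.tree) (i + 1)).edges ∧
          a ≠ degX Γ.tree (i + 1) + degY Γ.tree (i + 1) - 1 := by
      intro a b
      rw [ht]
      rfl
    -- If `r_2` had degree one, the top left vertex would be the branching one. Hence the deleted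
    -- edge is at `r_2`, and `q` does not change.
    have hnd' : degY Γ.tree (i + 1) ≠ 1 := by
      intro hd
      refine hnd ⟨.inl ⟨rfl, ?_, ?_⟩, .inr ⟨rfl, ?_, ?_⟩⟩ <;> simp only [degreeTree, hd] <;>
        have := D.q_pos (i + 1) (by omega) h1 <;> omega
    simp only [mem_degreeTree_edges] at he
    have e1 := he (degX Γ'.tree (i + 1)) 1
    have e2 := he (degX Γ.tree (i + 1)) 1
    have := D.q_pos (i + 1) (by omega) h1
    have := D.d_pos (i + 1) (by omega) h1
    have := D'.q_pos (i + 1) (by omega) h1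
    have := D'.d_pos (i + 1) (by omega) h1
    omega
  have addTwo (h1 : i + 2 < n) : degX Γ'.tree (i + 2) = degX Γ.tree (i + 2) + 1 ∧
      degY Γ'.tree (i + 2) = degY Γ.tree (i + 2) := by
    have ht := h.tree_add_two h1
    rw [Γ.tree_eq (by omega) h1, Γ'.tree_eq (by omega) h1] at ht
    have hp : degX Γ'.tree (i + 2) + degY Γ'.tree (i + 2) - 1 =
      degX Γ.tree (i + 2) + degY Γ.tree (i + 2) - 1 + 1 := congrArg BipGraph.p ht
    -- Comparing from position `2` upwards leaves out the inserted bottom vertex, so only the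
    -- renumbering remains.
    have he : ∀ a b, (a + 2, b) ∈ (degreeTree (degX Γ'.tree) (degY Γ'.tree) (i + 2)).edges ↔
        (a + 1, b) ∈ (degreeTree (degX Γ.tree) (degY Γ.tree) (i + 2)).edges := by
      intro a b
      rw [ht]
      simp
    simp only [mem_degreeTree_edges] at he
    have e1 := he (degX Γ'.tree (i + 2) - 2) 1
    have e2 := he (degX Γ.tree (i + 2) - 1) 1
    have := D.q_pos (i + 2) (by omega) h1
    have := D.d_pos (i + 2) (by omega) h1
    have := D'.q_pos (i + 2) (by omega) h1
    have := D'.d_pos (i + 2) (by omega) h1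
    omega
  refine ⟨h2, hi, self.1, self.2, fun h => (succ h).1, fun h => (succ h).2,
    fun h => (addTwo h).1, fun h => (addTwo h).2, fun k hk h0 h1 h2 => ?_, fun k hk h0 h1 h2 => ?_⟩
  · unfold degX
    split_ifs
    · rfl
    · rw [h.tree_other k (by omega) hk h0 h1 h2]
  · unfold degY
    split_ifs
    · rfl
    · rw [h.tree_other k (by omega) hk h0 h1 h2]

variable {i : ℕ} {q' d' : ℕ → ℕ}

/-! ### Comparing the routes before and after a move -/

namespace IsDegreeMove

variable (M : IsDegreeMove n i q d q' d')

include M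

/-- From `i + 3` on, the rules use only `q m` and `d (m-1)` with `m ≥ i + 3`. The smallest such `d`
is `d (i+2)`, which the move preserves. -/
theorem follows_iff_of_add_three_le {k a : ℕ} (hk : i + 3 ≤ k) {Q : List EdgeLabel}
    (h : IsPath n k Q n) : Follows q d a Q ↔ Follows q' d' a Q := by
  have h2 := M.two_le
  have hn : 2 ≤ n := by have := M.lt; omega
  induction Q generalizing k a with
  | nil => exact Iff.rfl
  | cons e Q ih =>
    obtain ⟨he, rfl, hQ⟩ := h
    have hlt := src_lt_tgt hn he
    cases e with
    | x m =>
      simp only [src, tgt, IsEdge] at *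
      have hd : d' (m - 1) = d (m - 1) := by
        rcases hk.eq_or_lt with rfl | hk
        · exact M.d_add_two (by omega)
        · exact M.d_other _ (by omega) (by omega) (by omega) (by omega)
      simp only [Follows, Admissible, stepIndex, hd,
        M.q_other m he.2 (by omega) (by omega) (by omega), ih (by omega) hQ]
    | y m =>
      simp only [src, IsEdge] at *
      simp only [Follows, Admissible, stepIndex,
        M.q_other m he (by omega) (by omega) (by omega), ih (by omega) hQ]

/-- The new bottom left vertex shifts positions by one. The shift disappears after one step:
`x_{i+2}` adds the diminished `d (i+1)`, and `y_{i+2}` subtracts the increased `q (i+2)`. -/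
theorem follows_iff_add_two {a : ℕ} {Q : List EdgeLabel} (h : IsPath n (i + 2) Q n) :
    Follows q d a Q ↔ Follows q' d' (a + 1) Q := by
  cases Q with
  | nil => exact Iff.rfl
  | cons e Q =>
    obtain ⟨he, hs, hQ⟩ := h
    have hn : 2 ≤ n := by have := M.lt; have := M.two_le; omega
    have hlt : i + 2 < n := by
      have := src_lt_tgt hn he
      have := tgt_le he
      omega
    have hq := M.q_add_two hlt
    have hd := M.d_succ (by omega)
    rcases eq_x_or_eq_y_of_src (by omega) hs with rfl | rfl
    · have e1 : i + 2 - 1 = i + 1 := rfl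
      have e2 : d' (i + 1) + (a + 1) = d (i + 1) + a := by omega
      simp only [Follows, Admissible, stepIndex, hq, e1, e2, add_le_add_iff_right,
        M.follows_iff_of_add_three_le le_rfl hQ]
    · have e2 : a + 1 + 1 - (q (i + 2) + 1) = a + 1 - q (i + 2) := by omega
      have := src_lt_tgt hn he
      rw [hs] at this
      simp only [Follows, Admissible, stepIndex, hq, e2, add_le_add_iff_right,
        M.follows_iff_of_add_three_le this hQ]

/-- Positions at `i + 1` are unshifted, but `x_{i+1}` adds `d i`, which has grown by one; this is
the shift expected at `i + 2`. -/
theorem follows_iff_succ {a : ℕ} {Q : List EdgeLabel} (h : IsPath n (i + 1) Q n) :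
    Follows q d a Q ↔ Follows q' d' a Q := by
  cases Q with
  | nil => exact Iff.rfl
  | cons e Q =>
    obtain ⟨he, hs, hQ⟩ := h
    have h2 := M.two_le
    have hn : 2 ≤ n := by have := M.lt; omega
    have hlt : i + 1 < n := by
      have := src_lt_tgt hn he
      have := tgt_le he
      omega
    have hq := M.q_succ hlt
    rcases eq_x_or_eq_y_of_src (by omega) hs with rfl | rfl
    · have e1 : i + 1 - 1 = i := rfl
      have e2 : d' i + a = d i + a + 1 := by rw [M.d_self]; omega
      simp only [Follows, Admissible, stepIndex, hq, e1, e2]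
      rw [M.follows_iff_add_two hQ]
    · simp only [Follows, Admissible, stepIndex, hq]
      rcases Nat.lt_or_ge (i + 2) n with h3 | h3
      · rw [M.follows_iff_of_add_three_le (k := i + 3) le_rfl]
        simpa only [tgt, min_eq_left (show i + 1 + 2 ≤ n by omega)] using hQ
      · have ht : tgt n (y (i + 1)) = n := min_eq_right (by omega)
        rw [ht] at hQ
        obtain rfl := hQ.eq_nil hn
        exact Iff.rfl

theorem follows_y_tail_iff {a : ℕ} {Q : List EdgeLabel} (h : IsPath n (tgt n (y i)) Q n) :
    Follows q d a Q ↔ Follows q' d' (a + 1) Q := by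
  have hn : 2 ≤ n := by have := M.lt; have := M.two_le; omega
  rcases Nat.lt_or_ge n (i + 2) with h3 | h3
  · have ht : tgt n (y i) = n := min_eq_right (by omega)
    rw [ht] at h
    obtain rfl := h.eq_nil hn
    exact Iff.rfl
  · have ht : tgt n (y i) = i + 2 := min_eq_left h3
    exact M.follows_iff_add_two (ht ▸ h)

/-- The only permission withdrawn is to leave position `q i` along `x_i`. All other changes of
degrees merely renumber the positions, as in the preceding lemmas. -/
theorem follows_or {k a : ℕ} (hk : k ≤ i) {Q : List EdgeLabel} (h : IsPath n k Q n)
    (hf : Follows q d a Q) :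
    Follows q' d' a Q ∨ ∃ A B, Q = A ++ x i :: B ∧ pathIndex q d a A = q i := by
  have h2 := M.two_le
  have hi := M.lt
  have hq := M.q_self
  induction Q generalizing k a with
  | nil => exact .inl trivial
  | cons e Q ih =>
    obtain ⟨he, rfl, hQ⟩ := h
    obtain ⟨ha, hf⟩ := hf
    have rest : tgt n e ≤ i → Admissible q' a e → stepIndex q d a e = stepIndex q' d' a e →
        Follows q' d' a (e :: Q) ∨ ∃ A B, e :: Q = A ++ x i :: B ∧ pathIndex q d a A = q i := by
      intro ht ha' hs
      rcases ih ht hQ hf with hf | ⟨A, B, rfl, hA⟩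
      · exact .inl ⟨ha', hs ▸ hf⟩
      · exact .inr ⟨e :: A, B, rfl, hA⟩
    cases e with
    | x m =>
      simp only [src, Admissible, stepIndex, IsEdge] at *
      have hd : d' (m - 1) = d (m - 1) :=
        M.d_other _ (by omega) (by omega) (by omega) (by omega)
      rcases hk.eq_or_lt with rfl | hk
      · rcases ha.eq_or_lt with rfl | ha
        · exact .inr ⟨[], Q, rfl, rfl⟩
        · refine .inl ⟨by simp only [Admissible]; omega, ?_⟩
          rw [stepIndex, hd]
          exact (M.follows_iff_succ hQ).1 hf
      · have := M.q_other m he.2 (by omega) (by omega) (by omega)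
        exact rest hk (by omega) (by rw [hd])
    | y m =>
      simp only [src, Admissible, stepIndex, IsEdge] at *
      rcases (show m ≤ i by omega).eq_or_lt with rfl | hm
      · refine .inl ⟨by simp only [Admissible]; omega, ?_⟩
        rw [stepIndex, show a + 1 - q' m = a + 1 - q m + 1 by omega]
        exact (M.follows_y_tail_iff hQ).1 hf
      · have hqm := M.q_other m he (by omega) (by omega) (by omega)
        -- For `m = i - 1` the edge jumps over `i` to `i + 1`, where the rules already agree without
        -- a shift.
        rcases Nat.lt_or_ge i (m + 2) with h3 | h3
        · have ht : tgt n (y m) = i + 1 := by simp only [tgt]; omega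
          refine .inl ⟨by simp only [Admissible]; omega, ?_⟩
          rw [stepIndex, hqm]
          exact (M.follows_iff_succ (ht ▸ hQ)).1 hf
        · exact rest (by simp only [tgt]; omega) (by omega) (by rw [hqm])

/-- Mirror image of `follows_or`: the only permission granted is to leave position `q' i` along
`y_i`. -/
theorem follows_or' {k a : ℕ} (hk : k ≤ i) {Q : List EdgeLabel} (h : IsPath n k Q n)
    (hf : Follows q' d' a Q) :
    Follows q d a Q ∨ ∃ A B, Q = A ++ y i :: B ∧ pathIndex q' d' a A = q' i := by
  have h2 := M.two_le
  have hi := M.lt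
  have hq := M.q_self
  induction Q generalizing k a with
  | nil => exact .inl trivial
  | cons e Q ih =>
    obtain ⟨he, rfl, hQ⟩ := h
    obtain ⟨ha, hf⟩ := hf
    have rest : tgt n e ≤ i → Admissible q a e → stepIndex q' d' a e = stepIndex q d a e →
        Follows q d a (e :: Q) ∨ ∃ A B, e :: Q = A ++ y i :: B ∧ pathIndex q' d' a A = q' i := by
      intro ht ha' hs
      rcases ih ht hQ hf with hf | ⟨A, B, rfl, hA⟩
      · exact .inl ⟨ha', hs ▸ hf⟩
      · exact .inr ⟨e :: A, B, rfl, hA⟩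
    cases e with
    | x m =>
      simp only [src, Admissible, stepIndex, IsEdge] at *
      have hd : d' (m - 1) = d (m - 1) :=
        M.d_other _ (by omega) (by omega) (by omega) (by omega)
      rcases hk.eq_or_lt with rfl | hk
      · refine .inl ⟨by simp only [Admissible]; omega, ?_⟩
        rw [stepIndex, ← hd]
        exact (M.follows_iff_succ hQ).2 hf
      · have := M.q_other m he.2 (by omega) (by omega) (by omega)
        exact rest hk (by omega) (by rw [hd])
    | y m =>
      simp only [src, Admissible, stepIndex, IsEdge] at *
      rcases (show m ≤ i by omega).eq_or_lt with rfl | hm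
      · rcases ha.eq_or_lt with rfl | ha
        · exact .inr ⟨[], Q, rfl, rfl⟩
        · refine .inl ⟨by simp only [Admissible]; omega, ?_⟩
          rw [show a + 1 - q' m = a + 1 - q m + 1 by omega] at hf
          exact (M.follows_y_tail_iff hQ).2 hf
      · have hqm := M.q_other m he (by omega) (by omega) (by omega)
        rcases Nat.lt_or_ge i (m + 2) with h3 | h3
        · have ht : tgt n (y m) = i + 1 := by simp only [tgt]; omega
          refine .inl ⟨by simp only [Admissible]; omega, ?_⟩
          rw [stepIndex, ← hqm]
          exact (M.follows_iff_succ (ht ▸ hQ)).2 hf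
        · exact rest (by simp only [tgt]; omega) (by omega) (by rw [hqm])

theorem prefix_congr {k a : ℕ} {A : List EdgeLabel} (h : IsPath n k A i) :
    pathIndex q d a A = pathIndex q' d' a A ∧ (Follows q d a A ↔ Follows q' d' a A) := by
  have h2 := M.two_le
  have hi := M.lt
  have hn : 2 ≤ n := by omega
  induction A generalizing k a with
  | nil => exact ⟨rfl, Iff.rfl⟩
  | cons e A ih =>
    obtain ⟨he, rfl, hA⟩ := h
    have hlt := (src_lt_tgt hn he).trans_le (hA.le hn)
    cases e with
    | x m =>
      simp only [src] at hlt
      have hd := M.d_other (m - 1) (by omega) (by omega) (by omega) (by omega)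
      have hq := M.q_other m (by omega) (by omega) (by omega) (by omega)
      simp only [pathIndex_cons, Follows, Admissible, stepIndex, hd, hq, ih hA, and_self]
    | y m =>
      simp only [src] at hlt
      have hq := M.q_other m (by omega) (by omega) (by omega) (by omega)
      simp only [pathIndex_cons, Follows, Admissible, stepIndex, hq, ih hA, and_self]

end IsDegreeMove

/-! ### Routes lost and gained, and their number -/

theorem isPath_of_append_cons {R : Route n} {A B : List EdgeLabel} {e : EdgeLabel}
    (h : R.1 = A ++ e :: B) : IsPath n 1 A (src e) := by
  have hR := R.2
  rw [h] at hR
  obtain ⟨c, hA, -, rfl, -⟩ := isPath_append.1 hR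
  exact hA

section Difference

variable (M : IsDegreeMove n i q d q' d') (D : IsDegreeSeq n q d) (D' : IsDegreeSeq n q' d')
  {P : List EdgeLabel}

include M D

theorem mem_followingRoutes_diff_iff (hP : P ∈ followingPrefixes n q d i)
    (hPi : pathIndex q d 1 P = q i) (R : Route n) :
    R ∈ followingRoutes n q d \ followingRoutes n q' d' ↔
      R ∈ followingRoutes n q d ∧ P ++ [x i] <+: R.1 := by
  refine and_congr_right fun hR => ⟨fun hR' => ?_, ?_⟩
  · obtain ⟨A, B, hAB, hA⟩ := (M.follows_or (by have := M.two_le; omega) R.2 hR).resolve_left hR'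
    have hf : Follows q d 1 R.1 := hR
    rw [hAB, follows_append] at hf
    obtain rfl := D.pathIndex_injOn M.lt ⟨isPath_of_append_cons hAB, hf.1⟩ hP (hA.trans hPi.symm)
    exact ⟨B, by simp [hAB]⟩
  · rintro ⟨B, hB⟩ hR'
    have hf : Follows q' d' 1 R.1 := hR'
    rw [← hB, follows_append, follows_concat, ← (M.prefix_congr hP.1).1, hPi] at hf
    have := hf.1.2
    have := M.q_self
    simp only [Admissible] at *
    omega

omit D in
include D' in
theorem mem_followingRoutes_diff_iff' (hP : P ∈ followingPrefixes n q' d' i)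
    (hPi : pathIndex q' d' 1 P = q' i) (R : Route n) :
    R ∈ followingRoutes n q' d' \ followingRoutes n q d ↔
      R ∈ followingRoutes n q' d' ∧ P ++ [y i] <+: R.1 := by
  have h2 := M.two_le
  have hs : src (y i) = i := max_eq_left (by omega)
  refine and_congr_right fun hR => ⟨fun hR' => ?_, ?_⟩
  · obtain ⟨A, B, hAB, hA⟩ := (M.follows_or' (by omega) R.2 hR).resolve_left hR'
    have hf : Follows q' d' 1 R.1 := hR
    rw [hAB, follows_append] at hf
    have hAp := isPath_of_append_cons hAB
    rw [hs] at hAp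
    obtain rfl := D'.pathIndex_injOn M.lt ⟨hAp, hf.1⟩ hP (hA.trans hPi.symm)
    exact ⟨B, by simp [hAB]⟩
  · rintro ⟨B, hB⟩ hR'
    have hf : Follows q d 1 R.1 := hR'
    rw [← hB, follows_append, follows_concat, (M.prefix_congr hP.1).1, hPi] at hf
    have := hf.1.2
    have := M.q_self
    simp only [Admissible] at *
    omega

end Difference

theorem existsUnique_route_iff {k : ℕ} {P : List EdgeLabel}
    (hP : P ∈ followingPrefixes n q d k) :
    (∃! R : Route n, R ∈ followingRoutes n q d ∧ P <+: R.1) ↔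
      UniqueSuffix n q d k (pathIndex q d 1 P) := by
  have route : ∀ Q, IsPath n k Q n → Follows q d (pathIndex q d 1 P) Q →
      ∃ R ∈ followingRoutes n q d, R.1 = P ++ Q := fun Q hQ hf =>
    ⟨⟨P ++ Q, isPath_append.2 ⟨k, hP.1, hQ⟩⟩, follows_append.2 ⟨hP.2, hf⟩, rfl⟩
  have tail : ∀ R ∈ followingRoutes n q d, ∀ Q, P ++ Q = R.1 →
      IsPath n k Q n ∧ Follows q d (pathIndex q d 1 P) Q := by
    intro R hR Q hQ
    have hf : Follows q d 1 R.1 := hR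
    have hp := R.2
    rw [← hQ] at hf hp
    obtain ⟨c, hPc, hQc⟩ := isPath_append.1 hp
    obtain rfl := hPc.end_unique hP.1
    exact ⟨hQc, (follows_append.1 hf).2⟩
  constructor
  · rintro ⟨R, ⟨hR, Q, hQ⟩, hu⟩
    refine ⟨Q, tail R hR Q hQ, fun Q' hQ' => ?_⟩
    obtain ⟨R', hR', hRQ'⟩ := route Q' hQ'.1 hQ'.2
    obtain rfl := hu R' ⟨hR', Q', hRQ'.symm⟩
    exact List.append_cancel_left (hRQ'.symm.trans hQ.symm)
  · rintro ⟨Q, ⟨hQ, hf⟩, hu⟩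
    obtain ⟨R, hR, hRQ⟩ := route Q hQ hf
    refine ⟨R, ⟨hR, Q, hRQ.symm⟩, ?_⟩
    rintro R' ⟨hR', Q', hQ'⟩
    refine Subtype.ext ?_
    rw [← hQ', hRQ, hu Q' (tail R' hR' Q' hQ')]

theorem followingPrefixes_concat {k : ℕ} {P : List EdgeLabel} {e : EdgeLabel}
    (hP : P ∈ followingPrefixes n q d k) (he : IsEdge n e) (hs : src e = k)
    (ha : Admissible q (pathIndex q d 1 P) e) :
    P ++ [e] ∈ followingPrefixes n q d (tgt n e) :=
  ⟨isPath_concat.2 ⟨hs ▸ hP.1, he, rfl⟩, follows_concat.2 ⟨hP.2, ha⟩⟩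

/-- The routes that the move deletes have the same ends as those that it creates. -/
theorem IsDegreeMove.uniqueSuffix_iff (M : IsDegreeMove n i q d q' d')
    (D : IsDegreeSeq n q d) (D' : IsDegreeSeq n q' d') :
    UniqueSuffix n q d (i + 1) (d (i - 1) + q i) ↔
      UniqueSuffix n q' d' (tgt n (y i)) (q' i + 1 - q' i) := by
  have h2 := M.two_le
  have hi := M.lt
  have hn : 2 ≤ n := by omega
  rw [Nat.add_sub_cancel_left]
  rcases Nat.lt_or_ge (i + 2) n with h3 | h3
  -- The lost routes reach the top left vertex of `γ_{i+1}`, which can only leave along `y_{i+1}`;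
  -- the gained ones reach the new bottom left vertex of the tree at `i + 2`, which can only leave
  -- along `x_{i+2}`. Both arrive at `i + 3` in position `d' (i+1) + 1`.
  · have hr := D.recurrence (i - 1) (by omega)
    rw [show i - 1 + 2 = i + 1 by omega, show i - 1 + 1 = i by omega] at hr
    have hd := M.d_succ (by omega)
    have hd' := D'.d_pos (i + 1) (by omega) (by omega)
    have hq := D.q_pos (i + 2) (by omega) h3
    have hq' := M.q_add_two h3
    have ht : tgt n (y i) = i + 2 := min_eq_left (by omega)
    rw [uniqueSuffix_iff_of_gt (by omega) (by omega) (by omega), ht,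
      uniqueSuffix_iff_of_lt (by omega) h3 (by omega), min_eq_left (show i + 1 + 2 ≤ n by omega),
      show d (i - 1) + q i + 1 - q (i + 1) = d' (i + 1) + 1 by omega]
    exact existsUnique_congr fun Q => and_congr_right fun hQ =>
      M.follows_iff_of_add_three_le le_rfl hQ
  · have ht : tgt n (y i) = n := min_eq_right h3
    rw [ht]
    refine iff_of_true ?_ (uniqueSuffix_self hn _)
    -- Here `y_i` already ends at the sink. Either `x_i` does too, or `i + 2 = n` and the top left
    -- vertex of the last tree has only the edge `y_{n-1}`.
    rcases (show i + 1 ≤ n from hi).eq_or_lt with h4 | h4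
    · rw [h4]
      exact uniqueSuffix_self hn _
    · have hr := D.recurrence (i - 1) (by omega)
      rw [show i - 1 + 2 = i + 1 by omega, show i - 1 + 1 = i by omega] at hr
      have hd := M.d_succ h4
      have hd' := D'.d_pos (i + 1) (by omega) h4
      rw [uniqueSuffix_iff_of_gt (by omega) h4 (by omega), min_eq_right (by omega)]
      exact uniqueSuffix_self hn _

theorem IsDegreeMove.dualGraph_adj_iff (M : IsDegreeMove n i q d q' d')
    (D : IsDegreeSeq n q d) (D' : IsDegreeSeq n q' d') {C C' : MaximalClique n}
    (hC : C.1 = followingRoutes n q d) (hC' : C'.1 = followingRoutes n q' d') :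
    (dualGraph n).Adj C.simplex C'.simplex ↔
      UniqueSuffix n q d (i + 1) (d (i - 1) + q i) := by
  have h2 := M.two_le
  have hi := M.lt
  have hi1 : 1 ≤ i := by omega
  have hd := D.d_pos i hi1 hi
  have hd' := D'.d_pos i hi1 hi
  have hq := D.q_pos i hi1 hi
  have hq' := D'.q_pos i hi1 hi
  obtain ⟨P, hP, hPi⟩ := D.exists_prefix hi1 hi (a := q i) ⟨hq, by omega⟩
  obtain ⟨P', hP', hPi'⟩ := D'.exists_prefix hi1 hi (a := q' i) ⟨hq', by omega⟩
  have hPx := followingPrefixes_concat hP (e := x i) ⟨hi1, hi⟩ rfl hPi.le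
  have hPy := followingPrefixes_concat hP' (e := y i) hi (max_eq_left hi1) hPi'.ge
  rw [ZigZag.dualGraph_adj_iff (by omega), hC, hC']
  simp only [mem_followingRoutes_diff_iff M D hP hPi, mem_followingRoutes_diff_iff' M D' hP' hPi',
    existsUnique_route_iff hPx, existsUnique_route_iff hPy, pathIndex_append, hPi, hPi',
    pathIndex_cons, pathIndex_nil]
  exact (and_congr_right fun _ => (M.uniqueSuffix_iff D D').symm).trans and_self_iff

end ZigZag

theorem mainTheorem4 (n i : ℕ) (Γ Γ' : ZigZag.Grove n) (hmove : ZigZag.IsPlusMove i Γ Γ') :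
    (∃! C : ZigZag.MaximalClique n, ZigZag.Corresponds C Γ) ∧
    (∃! C' : ZigZag.MaximalClique n, ZigZag.Corresponds C' Γ') ∧
    ∀ C C' : ZigZag.MaximalClique n, ZigZag.Corresponds C Γ → ZigZag.Corresponds C' Γ' →
      ((ZigZag.dualGraph n).Adj C.simplex C'.simplex ↔ some 0 ∉ Γ.offsets i) ∧
      (some 0 ∉ Γ.offsets i ↔
        ZigZag.Trackable n Γ.tree i ((Γ.tree i).topLeft 1) 1) ∧
      (ZigZag.Trackable n Γ.tree i ((Γ.tree i).topLeft 1) 1 ↔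
        ∃ P ∈ ZigZag.prefixesAt C.1 i,
          ZigZag.leftIndex C.1 i P = (Γ.tree i).topLeft 1 ∧
          ∃! R : ZigZag.Route n, R ∈ C.1 ∧ P ++ [ZigZag.EdgeLabel.x i] <+: R.1) := by
  open ZigZag in
  have h2 := hmove.two_le
  have hi := hmove.lt
  have hi1 : 1 ≤ i := by omega
  have hn : 3 ≤ n := by omega
  have D := Γ.isDegreeSeq hn
  have hγ := fun k (h : 2 ≤ k) (h' : k < n) => Γ.tree_eq h h'
  have hq := D.q_pos i hi1 hi
  have hd := D.d_pos i hi1 hi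
  have unique : ∀ Γ : Grove n, ∃! C : MaximalClique n, Corresponds C Γ := fun Γ =>
    ⟨Γ.maximalClique hn, (Γ.corresponds_iff hn _).2 rfl, fun C h => (Γ.corresponds_iff hn C).1 h⟩
  refine ⟨unique Γ, unique Γ', fun C C' hC hC' => ?_⟩
  obtain rfl := (Γ.corresponds_iff hn C).1 hC
  obtain rfl := (Γ'.corresponds_iff hn C').1 hC'
  have htop := topLeft_one hγ h2 hi hq
  have hedge : (degX Γ.tree i, 1) ∈ (Γ.tree i).edges := by
    rw [hγ i h2 hi, mem_degreeTree_edges]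
    omega
  have harr : arrival Γ.tree i (degX Γ.tree i) 1 = degY Γ.tree (i - 1) + degX Γ.tree i :=
    arrival_eq hγ h2 hi hedge
  have hadj := hmove.isDegreeMove.dualGraph_adj_iff D (Γ'.isDegreeSeq hn)
    (C := Γ.maximalClique hn) (C' := Γ'.maximalClique hn) rfl rfl
  have htrack := trackable_iff hγ D h2 hi hedge
  have hoff : some 0 ∉ Γ.offsets i ↔ UniqueSuffix n (degX Γ.tree) (degY Γ.tree) (i + 1)
      (degY Γ.tree (i - 1) + degX Γ.tree i) := by
    rw [Grove.offsets, htop, harr]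
    refine zero_notMem_offsetsFrom hγ D (by omega) (by omega) fun h => ?_
    refine D.validIndex_step (e := EdgeLabel.x i) ⟨hi1, hi⟩ h ⟨hq, ?_⟩ le_rfl
    change degX Γ.tree i + 1 ≤ degX Γ.tree i + degY Γ.tree i
    omega
  have hpre : prefixesAt (Γ.maximalClique hn).1 i =
      followingPrefixes n (degX Γ.tree) (degY Γ.tree) i := D.prefixesAt_followingRoutes hi1 hi
  have key : ∀ P ∈ followingPrefixes n (degX Γ.tree) (degY Γ.tree) i,
      pathIndex (degX Γ.tree) (degY Γ.tree) 1 P = degX Γ.tree i →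
      ((∃! R : Route n, R ∈ (Γ.maximalClique hn).1 ∧ P ++ [EdgeLabel.x i] <+: R.1) ↔
        UniqueSuffix n (degX Γ.tree) (degY Γ.tree) (i + 1)
          (degY Γ.tree (i - 1) + degX Γ.tree i)) := by
    intro P hP hPi
    have := existsUnique_route_iff
      (followingPrefixes_concat hP (e := EdgeLabel.x i) ⟨hi1, hi⟩ rfl hPi.le)
    rwa [pathIndex_append, hPi] at this
  rw [htop]
  -- Uniqueness of the suffix after the topmost edge at `r_1` is the common middle term of all the
  -- equivalences.
  refine ⟨hadj.trans hoff.symm, hoff.trans htrack.symm, htrack.trans ⟨fun hu => ?_, ?_⟩⟩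
  · obtain ⟨P, hP, hPi⟩ := D.exists_prefix hi1 hi (a := degX Γ.tree i) ⟨hq, by omega⟩
    exact ⟨P, hpre ▸ hP, (D.leftIndex_eq hi1 hi hpre hP).trans hPi, (key P hP hPi).2 hu⟩
  · rintro ⟨P, hP, hPi, hu⟩
    rw [hpre] at hP
    rw [D.leftIndex_eq hi1 hi hpre hP] at hPi
    exact (key P hP hPi).1 hu
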